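/- Let $H$ be a separable complex Hilbert space with inner product $(\cdot,\cdot)$, linear in the first argument, and let $A_c:\mathcal D_c\subset H\to H$ be a densely defined symmetric operator that is semibounded from below. Let $A=A_c^*$ with domain $\mathcal D_{\max}$, equipped with the inner product $(u,v)_A=(Au,Av)+(u,v)$, and let $\mathcal D_{\min}$ be the domain of the closure of $A_c$. Assume that the inclusion $\mathcal D_{\max}\hookrightarrow H$ is compact and that $\mathcal D_{\min}$ has finite positive codimension in $\mathcal D_{\max}$. Let $\mathcal E$ be the orthogonal complement of $\mathcal D_{\min}$ in $\mathcal D_{\max}$ with respect to $(\cdot,\cdot)_A$. For a subspace $D\subset\mathcal E$ let $D^\perp$ be its $(\cdot,\cdot)_A$-orthogonal complement in $\mathcal E$, let $\mathcal D=D+\mathcal D_{\min}$, and let $A_{\mathcal D}$ be $A$ restricted to $\mathcal D$; let $\mathfrak{SA}$ be the set of all $D\subset\mathcal E$ for which $A_{\mathcal D}$ is selfadjoint. For $D\in\mathfrak{SA}$ and $s\ge 0$ let $$H^s_{\mathcal D}=\Big\{u\in H:\ \|u\|_s^2=\sum_{\lambda\in\operatorname{spec}(A_{\mathcal D})}(1+|\lambda|)^{2s}\|\Pi_{\mathcal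 D,\lambda}u\|^2<\infty\Big\},$$ where $\Pi_{\mathcal D,\lambda}$ is the orthogonal projection of $H$ on $\ker(A_{\mathcal D}-\lambda)$, and let $H^{-s}_{\mathcal D^\dagger}$ be the dual of $(H^s_{\mathcal D},\|\cdot\|_s)$. One has $H^1_{\mathcal D}=\mathcal D$, and for $0\le s\le 1$ an element of $H^{-s}_{\mathcal D^\dagger}$ is identified with its restriction to $\mathcal D\subset H^s_{\mathcal D}$. For $u\in D^\perp$ let $\delta_u:\mathcal D\to\mathbb C$ be the functional $\delta_u(\psi)=(A\psi,u)-(\psi,Au)$, and let $\mathcal P_{D^\perp}=\{\delta_u:u\in D^\perp\}$. Theorem. The domain of the Friedrichs extension of $A_c$ (the selfadjoint operator associated with the closure of the quadratic form $(A_cx,y)$, $x,y\in\mathcal D_c$) has the form $D_F+\mathcal D_{\min}$ with $D_F\in\mathfrak{SA}$, and for every $D\in\mathfrak{SA}$ $$\mathcal P_{D^\perp}\cap H^{-1/2}_{\mathcal D^\dagger}=\{0\}\iff D=D_F .$$ -/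

import Mathlib

open Filter Topology

noncomputable section

namespace SADomains

variable {H : Type*} [NormedAddCommGroup H] [InnerProductSpace ℂ H]

/- Mathlib's `inner ℂ x y` is conjugate-linear in `x` and linear in `y`; the inner products
`(u, v)` of the mathematical text are linear in `u`, so `(u, v)` is `inner ℂ v u` below. -/

/-! ### Graph inner product and Green form of an unbounded operator -/

/-- The graph inner product `(u, v)_A = (A u, A v) + (u, v)` on the domain of `A`. -/
def graphInner (A : H →ₗ.[ℂ] H) (u v : A.domain) : ℂ :=
  inner ℂ (A v) (A u) + inner ℂ (v : H) (u : H)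

/-- The Green form `[u, v]_A = (A u, v) - (u, A v)` on the domain of `A`. -/
def greenForm (A : H →ₗ.[ℂ] H) (u v : A.domain) : ℂ :=
  inner ℂ (v : H) (A u) - inner ℂ (A v) (u : H)

/-- The orthogonal complement, in the domain of `A` with the graph inner product, of those
elements of the domain that lie in `S`. -/
def graphOrthogonal (A : H →ₗ.[ℂ] H) (S : Submodule ℂ H) : Submodule ℂ H where
  carrier := {u | ∃ hu : u ∈ A.domain, ∀ v : A.domain, (v : H) ∈ S →
    graphInner A ⟨u, hu⟩ v = 0}
  zero_mem' := by
    refine ⟨A.domain.zero_mem, fun v _ => ?_⟩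
    have h : (⟨0, A.domain.zero_mem⟩ : A.domain) = 0 := rfl
    rw [h]
    simp [graphInner]
  add_mem' := by
    rintro a b ⟨ha, ha'⟩ ⟨hb, hb'⟩
    refine ⟨A.domain.add_mem ha hb, fun v hv => ?_⟩
    have h : (⟨a + b, A.domain.add_mem ha hb⟩ : A.domain) = ⟨a, ha⟩ + ⟨b, hb⟩ := rfl
    have h1 := ha' v hv
    have h2 := hb' v hv
    simp only [graphInner] at h1 h2
    rw [h]
    simp only [graphInner, A.map_add, Submodule.coe_add, inner_add_right]
    linear_combination h1 + h2
  smul_mem' := by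
    rintro c a ⟨ha, ha'⟩
    refine ⟨A.domain.smul_mem c ha, fun v hv => ?_⟩
    have h : (⟨c • a, A.domain.smul_mem c ha⟩ : A.domain) = c • ⟨a, ha⟩ := rfl
    have h1 := ha' v hv
    simp only [graphInner] at h1
    rw [h]
    simp only [graphInner, A.map_smul, Submodule.coe_smul, inner_smul_right]
    linear_combination c * h1

/-! ### Spectrum and eigenspaces of an unbounded operator -/

/-- The spectrum of an unbounded operator `T`: all `μ : ℂ` for which `T - μ` has no bounded
everywhere defined two-sided inverse. -/
def spec (T : H →ₗ.[ℂ] H) : Set ℂ :=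
  {μ | ¬ ∃ R : H →L[ℂ] H,
    (∀ y : H, ∃ x : T.domain, (x : H) = R y ∧ T x - μ • (x : H) = y) ∧
    ∀ x : T.domain, R (T x - μ • (x : H)) = x}

/-- The space `ker (T - μ)`. -/
def eigenspace (T : H →ₗ.[ℂ] H) (μ : ℂ) : Submodule ℂ H where
  carrier := {u | ∃ hu : u ∈ T.domain, T ⟨u, hu⟩ = μ • u}
  zero_mem' := by
    refine ⟨T.domain.zero_mem, ?_⟩
    have h : (⟨0, T.domain.zero_mem⟩ : T.domain) = 0 := rfl
    rw [h, T.map_zero, smul_zero]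
  add_mem' := by
    rintro a b ⟨ha, ha'⟩ ⟨hb, hb'⟩
    refine ⟨T.domain.add_mem ha hb, ?_⟩
    have h : (⟨a + b, T.domain.add_mem ha hb⟩ : T.domain) = ⟨a, ha⟩ + ⟨b, hb⟩ := rfl
    rw [h, T.map_add, ha', hb', smul_add]
  smul_mem' := by
    rintro c a ⟨ha, ha'⟩
    refine ⟨T.domain.smul_mem c ha, ?_⟩
    have h : (⟨c • a, T.domain.smul_mem c ha⟩ : T.domain) = c • ⟨a, ha⟩ := rfl
    rw [h, T.map_smul, ha', smul_comm]

variable [CompleteSpace H]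

/-- The orthogonal projection of `H` on `ker (T - μ)`. For a closed operator `T`, in particular
for a selfadjoint one, the kernel is closed and taking its closure changes nothing; the closure
only makes the projection available for every `T`. -/
def eigenProj (T : H →ₗ.[ℂ] H) (μ : ℂ) : H →L[ℂ] H :=
  (eigenspace T μ).topologicalClosure.starProjection

/-! ### The Sobolev-like spaces of a selfadjoint operator and their duals -/

/-- The term `(1 + |μ|)^(2s) ‖Π_μ u‖²`. -/
def sobolevTerm (T : H →ₗ.[ℂ] H) (s : ℝ) (u : H) (μ : spec T) : ℝ :=
  (1 + ‖(μ : ℂ)‖) ^ (2 * s) * ‖eigenProj T μ u‖ ^ 2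

/-- The space `H^s` of `T`: all `u : H` with `∑_{μ ∈ spec T} (1 + |μ|)^(2s) ‖Π_μ u‖² < ∞`. -/
def sobolev (T : H →ₗ.[ℂ] H) (s : ℝ) : Submodule ℂ H where
  carrier := {u | Summable (sobolevTerm T s u)}
  zero_mem' := by
    have h : sobolevTerm T s 0 = fun _ => 0 := by
      funext μ
      simp [sobolevTerm]
    rw [Set.mem_ofPred_eq, h]
    exact summable_zero
  add_mem' := by
    intro a b ha hb
    refine Summable.of_nonneg_of_le (fun μ => ?_) (fun μ => ?_)
      ((ha.mul_left 2).add (hb.mul_left 2))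
    · unfold sobolevTerm
      positivity
    · have hw : 0 ≤ (1 + ‖(μ : ℂ)‖) ^ (2 * s) := by positivity
      have hn := norm_add_le (eigenProj T μ a) (eigenProj T μ b)
      have h2 : ‖eigenProj T μ a + eigenProj T μ b‖ ^ 2 ≤
          2 * ‖eigenProj T μ a‖ ^ 2 + 2 * ‖eigenProj T μ b‖ ^ 2 := by
        nlinarith [norm_nonneg (eigenProj T μ a + eigenProj T μ b),
          sq_nonneg (‖eigenProj T μ a‖ - ‖eigenProj T μ b‖)]
      have h3 := mul_le_mul_of_nonneg_left h2 hw
      simp only [sobolevTerm, map_add]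
      linarith
  smul_mem' := by
    intro c a ha
    have h : sobolevTerm T s (c • a) = fun μ => ‖c‖ ^ 2 * sobolevTerm T s a μ := by
      funext μ
      simp only [sobolevTerm, map_smul, norm_smul]
      ring
    rw [Set.mem_ofPred_eq, h]
    exact ha.mul_left _

/-- The norm `‖u‖_s` of `H^s`. -/
def sobolevNorm (T : H →ₗ.[ℂ] H) (s : ℝ) (u : sobolev T s) : ℝ :=
  √(∑' μ : spec T, sobolevTerm T s u μ)

/-- The functional `f` on the domain of `T` (which is `H^1` for `T` selfadjoint with compact
resolvent) belongs to `H^(-s)`, the dual of `H^s`: it is the restriction to the domain of a linear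
functional on `H^s` that is bounded for `‖·‖_s`. -/
def negSobolev (T : H →ₗ.[ℂ] H) (s : ℝ) : Set (Module.Dual ℂ T.domain) :=
  {f | ∃ ℓ : Module.Dual ℂ (sobolev T s),
    (∃ C : ℝ, ∀ w : sobolev T s, ‖ℓ w‖ ≤ C * sobolevNorm T s w) ∧
    ∀ ψ : T.domain, ∃ hψ : (ψ : H) ∈ sobolev T s, ℓ ⟨ψ, hψ⟩ = f ψ}

/-! ### Extensions of a symmetric operator -/

/-- The maximal operator `A`, the adjoint of `Ac`; its domain is `D_max`. -/
abbrev maxOp (Ac : H →ₗ.[ℂ] H) : H →ₗ.[ℂ] H := Ac.adjoint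

/-- `D_min`, the domain of the closure of `Ac`. -/
abbrev minDomain (Ac : H →ₗ.[ℂ] H) : Submodule ℂ H := Ac.closure.domain

/-- `ℰ`, the orthogonal complement of `D_min` in `D_max` for the graph inner product. -/
def defectSpace (Ac : H →ₗ.[ℂ] H) : Submodule ℂ H :=
  graphOrthogonal (maxOp Ac) (minDomain Ac)

/-- `D^⊥`, the orthogonal complement of `D` in `ℰ` for the graph inner product. -/
def perp (Ac : H →ₗ.[ℂ] H) (D : Submodule ℂ H) : Submodule ℂ H :=
  graphOrthogonal (maxOp Ac) D ⊓ defectSpace Ac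

/-- The operator `A` with domain `D + D_min`. -/
def extension (Ac : H →ₗ.[ℂ] H) (D : Submodule ℂ H) : H →ₗ.[ℂ] H :=
  (maxOp Ac).domRestrict (D ⊔ minDomain Ac)

/-- `𝔖𝔄`: the subspaces `D` of `ℰ` for which `A` with domain `D + D_min` is selfadjoint. -/
def selfadjointDomains (Ac : H →ₗ.[ℂ] H) : Set (Submodule ℂ H) :=
  {D | D ≤ defectSpace Ac ∧ IsSelfAdjoint (extension Ac D)}

/-- The functional `δ_u : D + D_min → ℂ`, `ψ ↦ [ψ, u]_A`. -/
def boundaryFunctional (Ac : H →ₗ.[ℂ] H) (D : Submodule ℂ H) (u : (maxOp Ac).domain) :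
    Module.Dual ℂ (extension Ac D).domain where
  toFun ψ := greenForm (maxOp Ac) ⟨ψ, ψ.2.2⟩ u
  map_add' x y := by
    have h : (⟨((x + y : (extension Ac D).domain) : H), (x + y).2.2⟩ : (maxOp Ac).domain) =
      ⟨x, x.2.2⟩ + ⟨y, y.2.2⟩ := rfl
    rw [h]
    simp only [greenForm, (maxOp Ac).map_add, Submodule.coe_add, inner_add_right]
    ring
  map_smul' c x := by
    have h : (⟨((c • x : (extension Ac D).domain) : H), (c • x).2.2⟩ : (maxOp Ac).domain) =
      c • ⟨x, x.2.2⟩ := rfl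
    rw [h]
    simp only [greenForm, (maxOp Ac).map_smul, Submodule.coe_smul, inner_smul_right,
      RingHom.id_apply, smul_eq_mul]
    ring

/-- `𝒫_{D^⊥} = {δ_u : u ∈ D^⊥}`, as functionals on `D + D_min`. -/
def boundaryFunctionals (Ac : H →ₗ.[ℂ] H) (D : Submodule ℂ H) :
    Set (Module.Dual ℂ (extension Ac D).domain) :=
  {f | ∃ u : (maxOp Ac).domain, (u : H) ∈ perp Ac D ∧ f = boundaryFunctional Ac D u}

/-! ### The Friedrichs extension -/

/-- The sequence `a` in the domain of `Ac` converges to `u` in `H` and is Cauchy for the form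
`q(x, y) = (Ac x, y)`. -/
def FormApprox (Ac : H →ₗ.[ℂ] H) (a : ℕ → Ac.domain) (u : H) : Prop :=
  Tendsto (fun n => (a n : H)) atTop (𝓝 u) ∧
  Tendsto (fun p : ℕ × ℕ => inner ℂ ((a p.1 - a p.2 : Ac.domain) : H) (Ac (a p.1 - a p.2)))
    atTop (𝓝 0)

/-- The domain of the Friedrichs extension of a semibounded operator `Ac`, that is, of the
operator associated with the closure `q̄` of the form `q(x, y) = (Ac x, y)`. The form domain of `q̄`
consists of the limits `u` of `q`-Cauchy sequences in the domain of `Ac`, with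
`q̄(u, v) = lim q(a n, b n)` for approximating sequences `a`, `b` of `u`, `v`; and `u` is in the
domain of the operator if and only if it is in the form domain and, for some `w : H`,
`q̄(u, v) = (w, v)` for all `v` in the form domain. -/
def friedrichsDomain (Ac : H →ₗ.[ℂ] H) : Set H :=
  {u | (∃ a, FormApprox Ac a u) ∧
    ∃ w : H, ∀ (a b : ℕ → Ac.domain) (v : H), FormApprox Ac a u → FormApprox Ac b v →
      Tendsto (fun n => inner ℂ (b n : H) (Ac (a n))) atTop (𝓝 (inner ℂ v w))}

end SADomains

end

namespace SADomains

section

variable {H : Type*} [NormedAddCommGroup H] [InnerProductSpace ℂ H]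

/-! ### Unbounded operators through their graphs -/

/-! Fix `D` in `𝔖𝔄` and let `T` be the selfadjoint operator `A` on `D + D_min`. The intersection in
question is the annihilator of `D_c` in the dual of `H^(1/2)`, so it is trivial exactly when `D_c`
is dense in the domain of `T` for the `H^(1/2)` norm, and that density singles out the Friedrichs
extension.

`H^(1/2)` is the form space of `T`. The lower bound of `A_c` passes to `D_min`, which has finite
codimension in `D_max`, so `T` has finitely many eigenvalues below it (`finite_eigenvalues_lt`).
Together with the compact embedding this gives a real `c` below all eigenvalues and a compact `(T -
c)⁻¹` (`exists_isResolvent_eigenvaluesGE`). Eigenvector expansion then makes `((T - c)x, x)`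
equivalent to `‖x‖²_{1/2}` (`sobolevNorm_sq_le`, `shiftedForm_le`).

Every `δ_u` vanishes on `D_c`, as `A` is the adjoint of `A_c`. Conversely, a graph-bounded
functional vanishing on `D_c` is `(·, v)_A` with `v ∈ ℰ`; since `A(Av) = -v` it equals `δ_{Av}`, and
symmetry of `T` puts `Av` in `D^⊥` (`mem_boundaryFunctionals`).

The Friedrichs domain is `D_max` intersected with the form domain, the image in `H` of the
completion `V` of `D_c` (`FormCompletion.mem_friedrichsDomain_iff`). If the annihilator is zero, the
domain of `T` lies in the form domain (`FormCompletion.domain_le`), and maximality of selfadjoint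
operators forces `D = D_F` (`FormCompletion.eq_defectDomain`). On the Friedrichs domain, form
approximation by `D_c` kills every functional in the intersection
(`FormCompletion.eq_zero_of_vanishes`). -/

lemma mem_eigenspace_iff {T : H →ₗ.[ℂ] H} {μ : ℂ} {u : H} :
    u ∈ eigenspace T μ ↔ (u, μ • u) ∈ T.graph := by
  rw [LinearPMap.mem_graph_iff]
  constructor
  · rintro ⟨hu, h⟩
    exact ⟨⟨u, hu⟩, rfl, h⟩
  · rintro ⟨y, rfl, h⟩
    exact ⟨y.2, h⟩

lemma eigenvalue_mem_spec {T : H →ₗ.[ℂ] H} {μ : ℂ} {u : H}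
    (h : u ∈ eigenspace T μ) (hu : u ≠ 0) : μ ∈ spec T := by
  rintro ⟨R, -, hR⟩
  obtain ⟨hd, he⟩ := h
  have := hR ⟨u, hd⟩
  rw [he] at this
  simp only [sub_self, map_zero] at this
  exact hu this.symm

variable [CompleteSpace H]

lemma mem_graph_adjoint_iff {T : H →ₗ.[ℂ] H} (hT : Dense (T.domain : Set H)) {u w : H} :
    (u, w) ∈ T.adjoint.graph ↔ ∀ x y, (x, y) ∈ T.graph → inner ℂ y u = inner ℂ x w := by
  rw [LinearPMap.adjoint_graph_eq_graph_adjoint hT, Submodule.mem_adjoint_iff]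
  simp only [sub_eq_zero]

lemma mem_graph_iff_of_isSelfAdjoint {T : H →ₗ.[ℂ] H} (hT : IsSelfAdjoint T) {u w : H} :
    (u, w) ∈ T.graph ↔ ∀ x y, (x, y) ∈ T.graph → inner ℂ y u = inner ℂ x w := by
  rw [← mem_graph_adjoint_iff hT.dense_domain, LinearPMap.isSelfAdjoint_def.1 hT]

lemma inner_graph_comm {T : H →ₗ.[ℂ] H} (hT : IsSelfAdjoint T) {x y u w : H}
    (h : (x, y) ∈ T.graph) (h' : (u, w) ∈ T.graph) : inner ℂ y u = inner ℂ x w :=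
  (mem_graph_iff_of_isSelfAdjoint hT).1 h' x y h

lemma inner_graph_self_im {T : H →ₗ.[ℂ] H} (hT : IsSelfAdjoint T) {x y : H}
    (h : (x, y) ∈ T.graph) : (inner ℂ x y).im = 0 := by
  have h1 : inner ℂ y x = inner ℂ x y := inner_graph_comm hT h h
  rw [← inner_conj_symm] at h1
  exact Complex.conj_eq_iff_im.1 h1

/-- Eigenvalues of a selfadjoint operator are real. -/
lemma eigenvalue_im {T : H →ₗ.[ℂ] H} (hT : IsSelfAdjoint T) {μ : ℂ} {u : H}
    (h : u ∈ eigenspace T μ) (hu : u ≠ 0) : μ.im = 0 := by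
  have h1 := inner_graph_self_im hT (mem_eigenspace_iff.1 h)
  rw [inner_smul_right, inner_self_eq_norm_sq_to_K] at h1
  have h2 : ‖u‖ ≠ 0 := norm_ne_zero_iff.2 hu
  have h3 : (μ * ((‖u‖ : ℝ) : ℂ) ^ 2).im = μ.im * ‖u‖ ^ 2 := by
    rw [← Complex.ofReal_pow, Complex.im_mul_ofReal]
  have h4 : μ.im * ‖u‖ ^ 2 = 0 := by rw [← h3]; exact h1
  simpa [h2] using h4

lemma eigenspace_isClosed {T : H →ₗ.[ℂ] H} (hT : IsSelfAdjoint T) (μ : ℂ) :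
    IsClosed (eigenspace T μ : Set H) := by
  have h : (eigenspace T μ : Set H) = (fun u : H => (u, μ • u)) ⁻¹' (T.graph : Set (H × H)) := by
    ext u
    exact mem_eigenspace_iff
  rw [h]
  exact IsClosed.preimage (by fun_prop) hT.isClosed

lemma eigenspace_topologicalClosure {T : H →ₗ.[ℂ] H} (hT : IsSelfAdjoint T) (μ : ℂ) :
    (eigenspace T μ).topologicalClosure = eigenspace T μ :=
  (eigenspace_isClosed hT μ).submodule_topologicalClosure_eq

lemma eigenProj_mem {T : H →ₗ.[ℂ] H} (hT : IsSelfAdjoint T) (μ : ℂ) (y : H) :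
    eigenProj T μ y ∈ eigenspace T μ := by
  rw [← eigenspace_topologicalClosure hT μ]
  exact Submodule.starProjection_apply_mem _ y

lemma inner_eigenProj_right (T : H →ₗ.[ℂ] H) {μ : ℂ} {e : H} (he : e ∈ eigenspace T μ)
    (y : H) : inner ℂ e (eigenProj T μ y) = inner ℂ e y := by
  rw [eigenProj, ← Submodule.inner_starProjection_left_eq_right,
    Submodule.starProjection_eq_self_iff.2 (Submodule.le_topologicalClosure _ he)]

lemma inner_eigenProj_self (T : H →ₗ.[ℂ] H) (μ : ℂ) (y : H) :
    inner ℂ y (eigenProj T μ y) = ((‖eigenProj T μ y‖ ^ 2 : ℝ) : ℂ) := by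
  have h : eigenProj T μ (eigenProj T μ y) = eigenProj T μ y :=
    Submodule.starProjection_eq_self_iff.2 (Submodule.starProjection_apply_mem _ y)
  rw [← h, eigenProj, ← Submodule.inner_starProjection_left_eq_right, inner_self_eq_norm_sq_to_K,
    ← eigenProj, h]
  simp

lemma eigenspace_orthogonal {T : H →ₗ.[ℂ] H} (hT : IsSelfAdjoint T) {μ ν : ℂ} (hμν : μ ≠ ν) :
    eigenspace T μ ⟂ eigenspace T ν := by
  rw [Submodule.isOrtho_iff_inner_eq]
  intro u hu v hv
  by_cases hu0 : u = 0
  · simp [hu0]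
  have him := Complex.conj_eq_iff_im.2 (eigenvalue_im hT hu hu0)
  have h := inner_graph_comm hT (mem_eigenspace_iff.1 hu) (mem_eigenspace_iff.1 hv)
  rw [inner_smul_left, inner_smul_right, him] at h
  have h2 : (μ - ν) * inner ℂ u v = 0 := by linear_combination h
  exact (mul_eq_zero.1 h2).resolve_left (sub_ne_zero.2 hμν)

/-! ### Spectral decomposition for a compact resolvent -/

/-- `R` is the inverse of `T - c`, for a real number `c`. -/
structure IsResolvent (T : H →ₗ.[ℂ] H) (c : ℝ) (R : H →L[ℂ] H) : Prop where
  mem_graph : ∀ y, (R y, y + (c : ℂ) • R y) ∈ T.graph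
  left_inv : ∀ x w, (x, w) ∈ T.graph → R (w - (c : ℂ) • x) = x

lemma IsResolvent.isSymmetric {T : H →ₗ.[ℂ] H} (hT : IsSelfAdjoint T) {c : ℝ} {R : H →L[ℂ] H}
    (hR : IsResolvent T c R) : (R : H →ₗ[ℂ] H).IsSymmetric := by
  intro y z
  have h := inner_graph_comm hT (hR.mem_graph y) (hR.mem_graph z)
  rw [inner_add_left, inner_add_right, inner_smul_left, inner_smul_right, Complex.conj_ofReal] at h
  simpa using (add_right_cancel h).symm

/-- The spectral theorem for the compact symmetric `R` transfers to `T`: an eigenvector of `R` for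
`κ` is one of `T` for `c + κ⁻¹`, and `κ = 0` is excluded because `R` is injective. -/
lemma eigenspaces_dense {T : H →ₗ.[ℂ] H} (hT : IsSelfAdjoint T) {c : ℝ} {R : H →L[ℂ] H}
    (hR : IsResolvent T c R) (hK : IsCompactOperator R) :
    (⨆ μ : spec T, eigenspace T μ).topologicalClosure = ⊤ := by
  rw [Submodule.topologicalClosure_eq_top_iff, eq_bot_iff,
    ← ContinuousLinearMap.orthogonalComplement_iSup_eigenspaces_eq_bot hK (hR.isSymmetric hT)]
  apply Submodule.orthogonal_le
  refine iSup_le fun κ u hu => ?_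
  rw [Module.End.mem_eigenspace_iff] at hu
  change R u = κ • u at hu
  by_cases hu0 : u = 0
  · rw [hu0]; exact Submodule.zero_mem _
  have hg := hR.mem_graph u
  have hκ : κ ≠ 0 := by
    rintro rfl
    rw [hu, zero_smul, smul_zero, add_zero] at hg
    exact hu0 (T.graph_fst_eq_zero_snd hg rfl)
  have h1 : u ∈ eigenspace T (c + κ⁻¹) := by
    rw [mem_eigenspace_iff]
    have := T.graph.smul_mem κ⁻¹ hg
    rw [hu] at this
    convert this using 1
    rw [Prod.smul_mk, smul_smul, smul_add, smul_smul, smul_smul, inv_mul_cancel₀ hκ, one_smul,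
      add_smul, add_comm]
    congr 3
    field_simp
  exact Submodule.mem_iSup_of_mem (p := fun μ : spec T => eigenspace T μ)
    ⟨_, eigenvalue_mem_spec h1 hu0⟩ h1

lemma hasSum_eigenProj {T : H →ₗ.[ℂ] H} (hT : IsSelfAdjoint T) {c : ℝ} {R : H →L[ℂ] H}
    (hR : IsResolvent T c R) (hK : IsCompactOperator R) (y : H) :
    HasSum (fun μ : spec T => eigenProj T μ y) y := by
  classical
  have : ∀ μ : spec T, CompleteSpace (eigenspace T (μ : ℂ)) := fun μ =>
    (eigenspace_isClosed hT μ).completeSpace_coe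
  have hS := IsHilbertSum.mkInternal (𝕜 := ℂ) (fun μ : spec T => eigenspace T (μ : ℂ))
    (OrthogonalFamily.of_pairwise fun μ ν h =>
      eigenspace_orthogonal hT fun h' => h (Subtype.ext h'))
    (eigenspaces_dense hT hR hK).ge
  have h := hS.hasSum_linearIsometryEquiv_symm (hS.linearIsometryEquiv y)
  rw [LinearIsometryEquiv.symm_apply_apply] at h
  convert h using 2 with μ
  -- Projecting the expansion onto one eigenspace leaves a single term, which identifies the
  -- abstract coefficient with `eigenProj T μ y`.
  have h2 := h.mapL (eigenProj T μ)
  refine h2.unique ?_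
  convert hasSum_ite_eq μ _ using 2 with ν
  split_ifs with hν
  · subst hν
    exact Submodule.starProjection_eq_self_iff.2
      (Submodule.le_topologicalClosure _ (Subtype.prop _))
  · refine (Submodule.starProjection_apply_eq_zero_iff _).2 ?_
    rw [eigenspace_topologicalClosure hT]
    refine (eigenspace_orthogonal hT fun h' => hν (Subtype.ext h')).le ?_
    exact Subtype.prop _

/-- The difference of the two sides is itself in the eigenspace. If it were nonzero, `μ` would be
real, and symmetry of `T` would make it orthogonal to itself. -/
lemma eigenProj_graph {T : H →ₗ.[ℂ] H} (hT : IsSelfAdjoint T) (μ : ℂ) {x w : H}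
    (h : (x, w) ∈ T.graph) : eigenProj T μ w = μ • eigenProj T μ x := by
  have hm : eigenProj T μ w - μ • eigenProj T μ x ∈ eigenspace T μ :=
    Submodule.sub_mem _ (eigenProj_mem hT μ w) (Submodule.smul_mem _ _ (eigenProj_mem hT μ x))
  rw [← sub_eq_zero]
  by_contra hne
  have him := Complex.conj_eq_iff_im.2 (eigenvalue_im hT hm hne)
  apply hne
  rw [← inner_self_eq_zero (𝕜 := ℂ)]
  nth_rw 2 [← map_smul]
  rw [← map_sub (eigenProj T μ), inner_eigenProj_right T hm, inner_sub_right,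
    ← inner_graph_comm hT (mem_eigenspace_iff.1 hm) h, inner_smul_left, inner_smul_right, him,
    sub_self]

/-! ### Norm and quadratic form as sums over the spectrum. -/

lemma hasSum_norm_sq {T : H →ₗ.[ℂ] H} (hT : IsSelfAdjoint T) {c : ℝ} {R : H →L[ℂ] H}
    (hR : IsResolvent T c R) (hK : IsCompactOperator R) (x : H) :
    HasSum (fun μ : spec T => ‖eigenProj T μ x‖ ^ 2) (‖x‖ ^ 2) := by
  have h := (hasSum_eigenProj hT hR hK x).mapL (innerSL ℂ x)
  simp only [innerSL_apply_apply, inner_eigenProj_self, inner_self_eq_norm_sq_to_K] at h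
  refine Complex.hasSum_ofReal.1 ?_
  simpa using h

lemma hasSum_form {T : H →ₗ.[ℂ] H} (hT : IsSelfAdjoint T) {c : ℝ} {R : H →L[ℂ] H}
    (hR : IsResolvent T c R) (hK : IsCompactOperator R) {x w : H} (h : (x, w) ∈ T.graph) :
    HasSum (fun μ : spec T => (μ : ℂ).re * ‖eigenProj T μ x‖ ^ 2) (inner ℂ x w).re := by
  have h1 := (hasSum_eigenProj hT hR hK w).mapL (innerSL ℂ x)
  have h2 := h1.mapL Complex.reCLM
  convert h2 using 2 with μ
  rw [innerSL_apply_apply, eigenProj_graph hT μ h, inner_smul_right, inner_eigenProj_self,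
    Complex.reCLM_apply, Complex.re_mul_ofReal]
  simp

/-- The shifted quadratic form `((T - c) x, x)` at a point `(x, w)` of the graph of `T`. -/
noncomputable def shiftedForm (c : ℝ) (p : H × H) : ℝ := (inner ℂ p.1 p.2).re - c * ‖p.1‖ ^ 2

lemma hasSum_shiftedForm {T : H →ₗ.[ℂ] H} (hT : IsSelfAdjoint T) {c : ℝ} {R : H →L[ℂ] H}
    (hR : IsResolvent T c R) (hK : IsCompactOperator R) {p : H × H} (h : p ∈ T.graph) :
    HasSum (fun μ : spec T => ((μ : ℂ).re - c) * ‖eigenProj T μ p.1‖ ^ 2) (shiftedForm c p) := by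
  simp only [sub_mul]
  exact (hasSum_form hT hR hK h).sub ((hasSum_norm_sq hT hR hK p.1).mul_left c)

/-- All eigenvalues of `T` are at least `b`. -/
def EigenvaluesGE (T : H →ₗ.[ℂ] H) (b : ℝ) : Prop :=
  ∀ (r : ℝ) (u : H), u ≠ 0 → (u, (r : ℂ) • u) ∈ T.graph → b ≤ r

/-- A point of the spectrum that is not an eigenvalue has zero projection, so termwise estimates
only need real `μ ≥ b`; it is never necessary to show that the spectrum consists of eigenvalues. -/
lemma eigenvalue_cases {T : H →ₗ.[ℂ] H} (hT : IsSelfAdjoint T) {b : ℝ} (hb : EigenvaluesGE T b)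
    (μ : ℂ) (x : H) : eigenProj T μ x = 0 ∨ (μ.im = 0 ∧ b ≤ μ.re) := by
  by_cases h0 : eigenProj T μ x = 0
  · exact Or.inl h0
  · have hm := eigenProj_mem hT μ x
    have him := eigenvalue_im hT hm h0
    refine Or.inr ⟨him, hb _ _ h0 ?_⟩
    rw [mem_eigenspace_iff] at hm
    rwa [Complex.conj_eq_iff_re.1 (Complex.conj_eq_iff_im.2 him)]

lemma norm_sq_le_shiftedForm {T : H →ₗ.[ℂ] H} (hT : IsSelfAdjoint T) {c : ℝ} {R : H →L[ℂ] H}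
    (hR : IsResolvent T c R) (hK : IsCompactOperator R) (hb : EigenvaluesGE T (c + 1))
    {p : H × H} (h : p ∈ T.graph) : ‖p.1‖ ^ 2 ≤ shiftedForm c p := by
  refine hasSum_le (fun μ => ?_) (hasSum_norm_sq hT hR hK p.1) (hasSum_shiftedForm hT hR hK h)
  rcases eigenvalue_cases hT hb μ p.1 with h0 | ⟨-, h1⟩
  · simp [h0]
  · exact le_mul_of_one_le_left (by positivity) (by linarith)

/-! ### Equivalence of the shifted form with the `H^(1/2)` norm. -/

lemma sobolevTerm_half (T : H →ₗ.[ℂ] H) (x : H) (μ : spec T) :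
    sobolevTerm T (1 / 2) x μ = (1 + ‖(μ : ℂ)‖) * ‖eigenProj T μ x‖ ^ 2 := by
  simp [sobolevTerm]

lemma sobolevTerm_nonneg (T : H →ₗ.[ℂ] H) (s : ℝ) (x : H) (μ : spec T) :
    0 ≤ sobolevTerm T s x μ := by
  unfold sobolevTerm
  positivity

lemma norm_eq_abs_re {μ : ℂ} (h : μ.im = 0) : ‖μ‖ = |μ.re| := by
  rw [← Complex.conj_eq_iff_re.1 (Complex.conj_eq_iff_im.2 h)]
  simp [Complex.norm_real]

/-- Since `μ - c ≥ 1`, one has `1 + |μ| ≤ 1 + |c| + (μ - c) ≤ (2 + |c|)(μ - c)`. -/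
lemma sobolevTerm_half_le {T : H →ₗ.[ℂ] H} (hT : IsSelfAdjoint T) {c : ℝ}
    (hb : EigenvaluesGE T (c + 1)) (x : H) (μ : spec T) :
    sobolevTerm T (1 / 2) x μ ≤
      (2 + |c|) * (((μ : ℂ).re - c) * ‖eigenProj T μ x‖ ^ 2) := by
  rw [sobolevTerm_half]
  rcases eigenvalue_cases hT hb μ x with h0 | ⟨h1, h2⟩
  · simp [h0]
  · rw [← mul_assoc, norm_eq_abs_re h1]
    refine mul_le_mul_of_nonneg_right ?_ (by positivity)
    have h3 : |(μ : ℂ).re| ≤ ((μ : ℂ).re - c) + |c| := by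
      have := abs_add_le ((μ : ℂ).re - c) c
      rw [sub_add_cancel, abs_of_nonneg (by linarith : 0 ≤ (μ : ℂ).re - c)] at this
      exact this
    nlinarith [abs_nonneg c]

lemma le_sobolevTerm_half {T : H →ₗ.[ℂ] H} (hT : IsSelfAdjoint T) {c : ℝ}
    (hb : EigenvaluesGE T (c + 1)) (x : H) (μ : spec T) :
    ((μ : ℂ).re - c) * ‖eigenProj T μ x‖ ^ 2 ≤ (1 + |c|) * sobolevTerm T (1 / 2) x μ := by
  rw [sobolevTerm_half]
  rcases eigenvalue_cases hT hb μ x with h0 | ⟨h1, h2⟩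
  · simp [h0]
  · rw [← mul_assoc, norm_eq_abs_re h1]
    refine mul_le_mul_of_nonneg_right ?_ (by positivity)
    have h3 := le_abs_self (μ : ℂ).re
    have h4 := neg_abs_le c
    nlinarith [abs_nonneg c, abs_nonneg (μ : ℂ).re]

lemma mem_sobolev_half {T : H →ₗ.[ℂ] H} (hT : IsSelfAdjoint T) {c : ℝ} {R : H →L[ℂ] H}
    (hR : IsResolvent T c R) (hK : IsCompactOperator R) (hb : EigenvaluesGE T (c + 1))
    {p : H × H} (h : p ∈ T.graph) : p.1 ∈ sobolev T (1 / 2) :=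
  Summable.of_nonneg_of_le (sobolevTerm_nonneg T _ _) (sobolevTerm_half_le hT hb p.1)
    ((hasSum_shiftedForm hT hR hK h).summable.mul_left _)

lemma domain_le_sobolev_half {T : H →ₗ.[ℂ] H} (hT : IsSelfAdjoint T) {c : ℝ} {R : H →L[ℂ] H}
    (hR : IsResolvent T c R) (hK : IsCompactOperator R) (hb : EigenvaluesGE T (c + 1)) :
    T.domain ≤ sobolev T (1 / 2) := fun x hx =>
  mem_sobolev_half hT hR hK hb (p := (x, T ⟨x, hx⟩)) (T.mem_graph ⟨x, hx⟩)

lemma sobolevNorm_sq (T : H →ₗ.[ℂ] H) (s : ℝ) (u : sobolev T s) :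
    sobolevNorm T s u ^ 2 = ∑' μ : spec T, sobolevTerm T s u μ :=
  Real.sq_sqrt (tsum_nonneg (sobolevTerm_nonneg T s u))

lemma sobolevNorm_sq_le {T : H →ₗ.[ℂ] H} (hT : IsSelfAdjoint T) {c : ℝ} {R : H →L[ℂ] H}
    (hR : IsResolvent T c R) (hK : IsCompactOperator R) (hb : EigenvaluesGE T (c + 1))
    {p : H × H} (h : p ∈ T.graph) (u : sobolev T (1 / 2)) (hu : (u : H) = p.1) :
    sobolevNorm T (1 / 2) u ^ 2 ≤ (2 + |c|) * shiftedForm c p := by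
  rw [sobolevNorm_sq, hu]
  have h1 := (hasSum_shiftedForm hT hR hK h).mul_left (2 + |c|)
  exact hasSum_le (sobolevTerm_half_le hT hb p.1)
    (mem_sobolev_half hT hR hK hb h : Summable _).hasSum h1

lemma shiftedForm_le {T : H →ₗ.[ℂ] H} (hT : IsSelfAdjoint T) {c : ℝ} {R : H →L[ℂ] H}
    (hR : IsResolvent T c R) (hK : IsCompactOperator R) (hb : EigenvaluesGE T (c + 1))
    {p : H × H} (h : p ∈ T.graph) (u : sobolev T (1 / 2)) (hu : (u : H) = p.1) :
    shiftedForm c p ≤ (1 + |c|) * sobolevNorm T (1 / 2) u ^ 2 := by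
  rw [sobolevNorm_sq, hu]
  exact hasSum_le (le_sobolevTerm_half hT hb p.1) (hasSum_shiftedForm hT hR hK h)
    ((mem_sobolev_half hT hR hK hb h : Summable _).hasSum.mul_left _)

end

section

variable {H : Type*} [NormedAddCommGroup H] [InnerProductSpace ℂ H]

/-! ### Existence of a compact resolvent -/

/-- The domain of `T` with the graph norm embeds compactly into `H`. -/
def CompactDomain (T : H →ₗ.[ℂ] H) : Prop :=
  ∃ S : Set H, IsCompact S ∧ ∀ x w, (x, w) ∈ T.graph → ‖w‖ ^ 2 + ‖x‖ ^ 2 ≤ 1 → x ∈ S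

lemma CompactDomain.mono {T T' : H →ₗ.[ℂ] H} (h : CompactDomain T) (hle : T'.graph ≤ T.graph) :
    CompactDomain T' := by
  obtain ⟨S, hS, h⟩ := h
  exact ⟨S, hS, fun x w hxw => h x w (hle hxw)⟩

/-- Otherwise there are unit vectors `x n` with `(T - c) x n → 0`; compactness and closedness
produce a nonzero limit in `ker (T - c)`. -/
lemma exists_norm_le_of_ker_eq_zero {T : H →ₗ.[ℂ] H} (hT : T.IsClosed) (hS : CompactDomain T)
    {c : ℝ} (hc : ∀ u, (u, (c : ℂ) • u) ∈ T.graph → u = 0) :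
    ∃ K : ℝ, 0 ≤ K ∧ ∀ x w, (x, w) ∈ T.graph → ‖x‖ ≤ K * ‖w - (c : ℂ) • x‖ := by
  obtain ⟨S, hS, hsub⟩ := hS
  by_contra! hcon
  have hex : ∀ n : ℕ, ∃ x w, (x, w) ∈ T.graph ∧ ‖x‖ = 1 ∧
      ‖w - (c : ℂ) • x‖ < 1 / ((n : ℝ) + 1) := by
    intro n
    obtain ⟨x, w, hxw, hlt⟩ := hcon (n + 1) (by positivity)
    have hx : 0 < ‖x‖ := lt_of_le_of_lt (by positivity) hlt
    refine ⟨((‖x‖⁻¹ : ℝ) : ℂ) • x, ((‖x‖⁻¹ : ℝ) : ℂ) • w, T.graph.smul_mem _ hxw, ?_, ?_⟩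
    · rw [norm_smul, Complex.norm_real, norm_inv, norm_norm, inv_mul_cancel₀ hx.ne']
    · rw [smul_comm, ← smul_sub, norm_smul, Complex.norm_real, norm_inv, norm_norm,
        lt_div_iff₀ (by positivity), inv_mul_eq_div, div_mul_eq_mul_div, div_lt_one hx, mul_comm]
      exact hlt
  choose x w hg hx hw using hex
  -- Scaling by `r` brings `(x n, w n)` into the unit ball of the graph norm, because `(1 + |c|)² +
  -- 1 ≤ (2 + |c|)²`.
  set r : ℝ := 1 / (2 + |c|) with hr
  have hc0 := abs_nonneg c
  have hr0 : 0 < r := by positivity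
  have hmem : ∀ n, (r : ℂ) • x n ∈ S := by
    intro n
    refine hsub _ ((r : ℂ) • w n) (T.graph.smul_mem _ (hg n)) ?_
    have h1 : ‖w n‖ ≤ 1 + |c| := by
      calc ‖w n‖ = ‖(w n - (c : ℂ) • x n) + (c : ℂ) • x n‖ := by rw [sub_add_cancel]
        _ ≤ ‖w n - (c : ℂ) • x n‖ + ‖(c : ℂ) • x n‖ := norm_add_le _ _
        _ ≤ 1 + |c| := by
          gcongr
          · exact (hw n).le.trans (by rw [div_le_one (by positivity)]; linarith [n.cast_nonneg (α := ℝ)])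
          · rw [norm_smul, hx, mul_one, Complex.norm_real, Real.norm_eq_abs]
    rw [norm_smul, norm_smul, hx, Complex.norm_real, Real.norm_of_nonneg hr0.le, mul_pow, mul_pow,
      ← mul_add, hr, div_pow, one_pow, div_mul_eq_mul_div, one_mul, div_le_one (by positivity)]
    nlinarith [norm_nonneg (w n)]
  obtain ⟨z, -, φ, hφ, hz⟩ := hS.tendsto_subseq hmem
  have hzn : ‖z‖ = r := by
    refine tendsto_nhds_unique hz.norm ?_
    simp only [Function.comp_def, norm_smul, hx, Complex.norm_real, Real.norm_of_nonneg hr0.le,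
      mul_one]
    exact tendsto_const_nhds
  have hd : Tendsto (fun n => w n - (c : ℂ) • x n) atTop (𝓝 0) :=
    squeeze_zero_norm (fun n => (hw n).le) tendsto_one_div_add_atTop_nhds_zero_nat
  have hwz : Tendsto (fun n => (r : ℂ) • w (φ n)) atTop (𝓝 ((c : ℂ) • z)) := by
    have h1 := ((hd.comp hφ.tendsto_atTop).const_smul (r : ℂ)).add (hz.const_smul (c : ℂ))
    rw [smul_zero, zero_add] at h1
    refine h1.congr fun n => ?_
    simp only [Function.comp_apply]
    module
  have hzg : (z, (c : ℂ) • z) ∈ T.graph :=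
    hT.mem_of_tendsto (hz.prodMk_nhds hwz)
      (Eventually.of_forall fun n => T.graph.smul_mem (r : ℂ) (hg (φ n)))
  rw [hc z hzg, norm_zero] at hzn
  exact hr0.ne hzn

variable [CompleteSpace H]

/-- Viewed as a bounded map on the complete graph, `T - c` is bounded below, so its range is closed;
the orthogonal complement of the range is `ker (T - c) = 0`, so it is onto. -/
lemma exists_isResolvent {T : H →ₗ.[ℂ] H} (hT : IsSelfAdjoint T) (hS : CompactDomain T)
    {c : ℝ} (hc : ∀ u, (u, (c : ℂ) • u) ∈ T.graph → u = 0) :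
    ∃ R : H →L[ℂ] H, IsResolvent T c R ∧ IsCompactOperator R := by
  obtain ⟨K, hK0, hK⟩ := exists_norm_le_of_ker_eq_zero hT.isClosed hS hc
  let L : T.graph →L[ℂ] H :=
    (ContinuousLinearMap.snd ℂ H H - (c : ℂ) • ContinuousLinearMap.fst ℂ H H).comp T.graph.subtypeL
  have hL : ∀ p : T.graph, L p = p.1.2 - (c : ℂ) • p.1.1 := fun p => rfl
  have hbound : ∀ p : T.graph, ‖p.1.1‖ ≤ K * ‖L p‖ := fun p => hK _ _ p.2
  have hcomplete : CompleteSpace T.graph := hT.isClosed.completeSpace_coe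
  have hanti : AntilipschitzWith (Real.toNNReal (1 + (1 + |c|) * K)) L := by
    refine AddMonoidHomClass.antilipschitz_of_bound L fun p => ?_
    rw [Real.coe_toNNReal _ (by positivity)]
    change max ‖p.1.1‖ ‖p.1.2‖ ≤ _
    have h1 := hbound p
    have h2 : ‖p.1.2‖ ≤ ‖L p‖ + |c| * ‖p.1.1‖ := by
      calc ‖p.1.2‖ = ‖L p + (c : ℂ) • p.1.1‖ := by rw [hL, sub_add_cancel]
        _ ≤ ‖L p‖ + ‖(c : ℂ) • p.1.1‖ := norm_add_le _ _
        _ = _ := by rw [norm_smul, Complex.norm_real, Real.norm_eq_abs]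
    have h3 : 0 ≤ |c| := abs_nonneg c
    have h4 : 0 ≤ ‖L p‖ := norm_nonneg _
    have h5 := mul_le_mul_of_nonneg_left h1 h3
    have h6 : 0 ≤ |c| * (K * ‖L p‖) := by positivity
    refine max_le ?_ ?_ <;> nlinarith
  have hclosed : IsClosed (LinearMap.range L.toLinearMap : Set H) :=
    hanti.isClosed_range L.uniformContinuous
  have hrange : LinearMap.range L.toLinearMap = ⊤ := by
    rw [← hclosed.submodule_topologicalClosure_eq, Submodule.topologicalClosure_eq_top_iff,
      eq_bot_iff]
    intro z hz
    rw [Submodule.mem_orthogonal] at hz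
    refine hc z ((mem_graph_iff_of_isSelfAdjoint hT).2 fun x y hxy => ?_)
    have := hz _ ⟨⟨(x, y), hxy⟩, rfl⟩
    change inner ℂ (y - (c : ℂ) • x) z = 0 at this
    rw [inner_sub_left, inner_smul_left, Complex.conj_ofReal, sub_eq_zero] at this
    rw [this, inner_smul_right]
  let e := LinearEquiv.ofBijective L.toLinearMap
    ⟨hanti.injective, LinearMap.range_eq_top.1 hrange⟩
  have he : ∀ y, L (e.symm y) = y := fun y => e.apply_symm_apply y
  have he' : ∀ p, e.symm (L p) = p := fun p => e.symm_apply_apply p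
  let R : H →L[ℂ] H := LinearMap.mkContinuous
    ((LinearMap.fst ℂ H H ∘ₗ T.graph.subtype) ∘ₗ e.symm.toLinearMap) K fun y => by
      have := hbound (e.symm y)
      rwa [he] at this
  have hR : ∀ y, R y = (e.symm y).1.1 := fun y => rfl
  have hres : IsResolvent T c R := by
    refine ⟨fun y => ?_, fun x w h => ?_⟩
    · have h1 := he y
      rw [hL, sub_eq_iff_eq_add] at h1
      rw [hR, ← h1]
      exact (e.symm y).2
    · rw [hR]
      exact congrArg (fun p : T.graph => p.1.1) (he' ⟨(x, w), h⟩)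
  refine ⟨R, hres, ?_⟩
  obtain ⟨S, hS, hsub⟩ := hS
  refine ⟨S, hS, ?_⟩
  -- For `y` near `0` the graph norm of `R y` is at most `1`, so `R` maps a neighbourhood of `0`
  -- into the compact set `S`.
  have hcont : Tendsto (fun y => ‖y + (c : ℂ) • R y‖ ^ 2 + ‖R y‖ ^ 2) (𝓝 0) (𝓝 0) := by
    have : Continuous fun y => ‖y + (c : ℂ) • R y‖ ^ 2 + ‖R y‖ ^ 2 := by fun_prop
    simpa using this.tendsto 0
  filter_upwards [hcont.eventually (eventually_le_nhds (zero_lt_one' ℝ))] with y hy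
  exact hsub _ _ (hres.mem_graph y) hy

/-- If `T` is bounded below by `m` on a subspace of finite codimension, then it has only finitely
many eigenvalues below `m`. -/
lemma finite_eigenvalues_lt {T : H →ₗ.[ℂ] H} (hT : IsSelfAdjoint T) {P M : Submodule ℂ H}
    (hP : T.domain ≤ P) [FiniteDimensional ℂ (P ⧸ M.submoduleOf P)] {m : ℝ}
    (hm : ∀ x w, (x, w) ∈ T.graph → x ∈ M → m * ‖x‖ ^ 2 ≤ (inner ℂ x w).re) :
    {r : ℝ | r < m ∧ ∃ u, u ≠ 0 ∧ (u, (r : ℂ) • u) ∈ T.graph}.Finite := by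
  set E := {r : ℝ | r < m ∧ ∃ u, u ≠ 0 ∧ (u, (r : ℂ) • u) ∈ T.graph} with hE
  have hex : ∀ r : E, ∃ u : H, ‖u‖ = 1 ∧ (u, ((r : ℝ) : ℂ) • u) ∈ T.graph := by
    rintro ⟨r, -, u, hu, h⟩
    have hu' : ‖u‖ ≠ 0 := norm_ne_zero_iff.2 hu
    refine ⟨((‖u‖⁻¹ : ℝ) : ℂ) • u, ?_, ?_⟩
    · rw [norm_smul, Complex.norm_real, norm_inv, norm_norm, inv_mul_cancel₀ hu']
    · rw [smul_comm]
      exact T.graph.smul_mem _ h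
  choose e he1 heg using hex
  have hon : Orthonormal ℂ e := by
    refine ⟨he1, fun r s hrs => ?_⟩
    refine (Submodule.isOrtho_iff_inner_eq.1 (eigenspace_orthogonal hT ?_)) _
      (mem_eigenspace_iff.2 (heg r)) _ (mem_eigenspace_iff.2 (heg s))
    exact fun h => hrs (Subtype.ext (Complex.ofReal_injective h))
  have hePm : ∀ r, e r ∈ P := fun r => hP (LinearPMap.mem_domain_of_mem_graph (heg r))
  -- Normalized eigenvectors for distinct eigenvalues `r < m` stay independent modulo `M`: on a
  -- combination lying in `M` the form is `∑ r |g|²`, yet at least `m ∑ |g|²`, so all coefficients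
  -- vanish.
  have hli : LinearIndependent ℂ
      fun r : E => (M.submoduleOf P).mkQ ⟨e r, hePm r⟩ := by
    rw [linearIndependent_iff']
    intro s g hg i hi
    have hq : (M.submoduleOf P).mkQ (∑ i ∈ s, g i • ⟨e i, hePm i⟩) = 0 := by
      rw [map_sum]
      simpa only [map_smul] using hg
    have hv : ∑ i ∈ s, g i • e i ∈ M := by
      rw [Submodule.mkQ_apply, Submodule.Quotient.mk_eq_zero, Submodule.submoduleOf,
        Submodule.mem_comap] at hq
      simpa using hq
    have hvg : (∑ i ∈ s, g i • e i, ∑ i ∈ s, (g i * ((i : ℝ) : ℂ)) • e i) ∈ T.graph := by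
      rw [prod_mk_sum]
      refine T.graph.sum_mem fun i _ => ?_
      rw [mul_smul]
      exact T.graph.smul_mem (g i) (heg i)
    have h1 := hm _ _ hvg hv
    have h2 : ‖∑ i ∈ s, g i • e i‖ ^ 2 = ∑ i ∈ s, ‖g i‖ ^ 2 := by
      have h := hon.inner_sum g g s
      simp only [inner_self_eq_norm_sq_to_K, Complex.conj_mul'] at h
      refine Complex.ofReal_injective ?_
      simpa using h
    have h3 : (inner ℂ (∑ i ∈ s, g i • e i) (∑ i ∈ s, (g i * ((i : ℝ) : ℂ)) • e i)).re =
        ∑ i ∈ s, (i : ℝ) * ‖g i‖ ^ 2 := by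
      rw [hon.inner_sum, Complex.re_sum]
      refine Finset.sum_congr rfl fun j _ => ?_
      rw [← mul_assoc, Complex.conj_mul', ← Complex.ofReal_pow, ← Complex.ofReal_mul,
        Complex.ofReal_re, mul_comm]
    rw [h2, h3, Finset.mul_sum, ← sub_nonpos, ← Finset.sum_sub_distrib] at h1
    have h4 : ∀ j ∈ s, 0 ≤ m * ‖g j‖ ^ 2 - (j : ℝ) * ‖g j‖ ^ 2 := fun j _ => by
      rw [← sub_mul]
      exact mul_nonneg (sub_nonneg.2 j.2.1.le) (by positivity)
    have h5 := (Finset.sum_eq_zero_iff_of_nonneg h4).1 (le_antisymm h1 (Finset.sum_nonneg h4)) i hi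
    rw [← sub_mul] at h5
    simpa using (mul_eq_zero.1 h5).resolve_left (sub_pos.2 i.2.1).ne'
  have := hli.finite_of_isNoetherian
  exact Set.toFinite E

lemma exists_isResolvent_eigenvaluesGE {T : H →ₗ.[ℂ] H} (hT : IsSelfAdjoint T)
    (hS : CompactDomain T) {P M : Submodule ℂ H}
    (hP : T.domain ≤ P) [FiniteDimensional ℂ (P ⧸ M.submoduleOf P)] {m : ℝ}
    (hm : ∀ x w, (x, w) ∈ T.graph → x ∈ M → m * ‖x‖ ^ 2 ≤ (inner ℂ x w).re) :
    ∃ (c : ℝ) (R : H →L[ℂ] H), IsResolvent T c R ∧ IsCompactOperator R ∧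
      EigenvaluesGE T (c + 1) := by
  obtain ⟨b, hb⟩ := (finite_eigenvalues_lt hT hP hm).bddBelow
  -- `b` bounds the eigenvalues below `m`, and `m` bounds the others. Subtracting `1` keeps the
  -- shift off the eigenvalues and every weight `μ - c` at least `1`.
  have hge : EigenvaluesGE T (min b m - 1 + 1) := by
    intro r u hu h
    rw [sub_add_cancel]
    by_cases hr : r < m
    · exact (min_le_left _ _).trans (hb ⟨hr, u, hu, h⟩)
    · exact (min_le_right _ _).trans (not_lt.1 hr)
  obtain ⟨R, h1, h2⟩ := exists_isResolvent hT hS (c := min b m - 1) fun u hu => by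
    by_contra h0
    have := hge _ u h0 hu
    linarith
  exact ⟨_, R, h1, h2, hge⟩

end

section

universe u

variable {H : Type u} [NormedAddCommGroup H] [InnerProductSpace ℂ H]

/-! ### The completion of the form domain -/

/-- `V` is the completion of the domain of `Ac` for the form `(Ac x, y) + c (x, y)`. -/
structure FormCompletion (Ac : H →ₗ.[ℂ] H) (c : ℝ) (V : Type*) [NormedAddCommGroup V]
    [InnerProductSpace ℂ V] where
  /-- The inclusion of the domain of `Ac`. -/
  incl : Ac.domain →ₗ[ℂ] V
  /-- The map to the ambient Hilbert space. -/
  toH : V →L[ℂ] H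
  dense : DenseRange incl
  toH_incl : ∀ x, toH (incl x) = x
  inner_incl : ∀ x y, inner ℂ (incl x) (incl y) =
    inner ℂ (x : H) (Ac y) + c * inner ℂ (x : H) (y : H)

/-- The inner product `(Ac x, y) + c (x, y)` on the domain of `Ac`. -/
@[reducible] noncomputable def formCore (Ac : H →ₗ.[ℂ] H) (hsymm : Ac.IsFormalAdjoint Ac) {c : ℝ}
    (hc : ∀ x : Ac.domain, ‖(x : H)‖ ^ 2 ≤ (inner ℂ (x : H) (Ac x)).re + c * ‖(x : H)‖ ^ 2) :
    InnerProductSpace.Core ℂ Ac.domain where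
  inner x y := inner ℂ (x : H) (Ac y) + c * inner ℂ (x : H) (y : H)
  conj_inner_symm x y := by
    rw [map_add, map_mul, inner_conj_symm, inner_conj_symm, Complex.conj_ofReal, hsymm]
  re_inner_nonneg x := by
    have h := hc x
    have h2 : (c * inner ℂ (x : H) (x : H) : ℂ).re = c * ‖(x : H)‖ ^ 2 := by
      rw [Complex.re_ofReal_mul, inner_self_eq_norm_sq_to_K]
      norm_cast
    change 0 ≤ (inner ℂ (x : H) (Ac x) + c * inner ℂ (x : H) (x : H) : ℂ).re
    rw [Complex.add_re, h2]
    exact (sq_nonneg _).trans h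
  add_left x y z := by
    simp only [Submodule.coe_add, inner_add_left]
    ring
  smul_left x y r := by
    simp only [Submodule.coe_smul, inner_smul_left]
    ring
  definite x h := by
    have h1 := hc x
    have h2 : (c * inner ℂ (x : H) (x : H) : ℂ).re = c * ‖(x : H)‖ ^ 2 := by
      rw [Complex.re_ofReal_mul, inner_self_eq_norm_sq_to_K]
      norm_cast
    have h3 := congrArg Complex.re h
    rw [Complex.add_re, h2] at h3
    rw [h3] at h1
    simpa using h1

/-- The domain of `Ac`, to be normed by its form. -/
def PreFormSpace (Ac : H →ₗ.[ℂ] H) : Type u := Ac.domain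

/-- The type synonym keeps the form norm apart from the norm that `Ac.domain` inherits from `H`. -/
lemma exists_preFormSpace (Ac : H →ₗ.[ℂ] H) (hsymm : Ac.IsFormalAdjoint Ac) {c : ℝ}
    (hc : ∀ x : Ac.domain, ‖(x : H)‖ ^ 2 ≤ (inner ℂ (x : H) (Ac x)).re + c * ‖(x : H)‖ ^ 2) :
    ∃ (W : Type u) (_ : NormedAddCommGroup W) (_ : InnerProductSpace ℂ W)
      (e : W ≃ₗ[ℂ] Ac.domain), ∀ x y, inner ℂ x y =
        inner ℂ (e x : H) (Ac (e y)) + c * inner ℂ (e x : H) (e y : H) := by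
  let i0 : AddCommGroup (PreFormSpace Ac) := inferInstanceAs (AddCommGroup Ac.domain)
  let i1 : Module ℂ (PreFormSpace Ac) := inferInstanceAs (Module ℂ Ac.domain)
  let i2 : NormedAddCommGroup (PreFormSpace Ac) :=
    @InnerProductSpace.Core.toNormedAddCommGroup ℂ (PreFormSpace Ac) _ i0 i1 (formCore Ac hsymm hc)
  let i3 : InnerProductSpace ℂ (PreFormSpace Ac) :=
    @InnerProductSpace.ofCore ℂ (PreFormSpace Ac) _ i0 i1 (formCore Ac hsymm hc).toCore
  exact ⟨PreFormSpace Ac, i2, i3, LinearEquiv.refl ℂ Ac.domain, fun x y => rfl⟩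

/-- The bound `hc` makes the inclusion into `H` a contraction for the form norm, so it extends to
the completion. -/
lemma exists_formCompletion [CompleteSpace H] (Ac : H →ₗ.[ℂ] H) (hsymm : Ac.IsFormalAdjoint Ac)
    {c : ℝ}
    (hc : ∀ x : Ac.domain, ‖(x : H)‖ ^ 2 ≤ (inner ℂ (x : H) (Ac x)).re + c * ‖(x : H)‖ ^ 2) :
    ∃ (V : Type u) (_ : NormedAddCommGroup V) (_ : InnerProductSpace ℂ V) (_ : CompleteSpace V),
      Nonempty (FormCompletion Ac c V) := by
  obtain ⟨W, _, _, e, he⟩ := exists_preFormSpace Ac hsymm hc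
  have hb : ∀ x, ‖(Ac.domain.subtype ∘ₗ e.toLinearMap) x‖ ≤ 1 * ‖x‖ := by
    intro x
    rw [one_mul]
    refine (sq_le_sq₀ (norm_nonneg _) (norm_nonneg _)).1 ((hc (e x)).trans_eq ?_)
    have h := inner_self_eq_norm_sq (𝕜 := ℂ) x
    rw [he, map_add, RCLike.re_eq_complex_re, Complex.re_ofReal_mul,
      inner_self_eq_norm_sq_to_K] at h
    refine Eq.trans ?_ h
    norm_cast
  let L : W →L[ℂ] H := LinearMap.mkContinuous _ 1 hb
  let ι : W →L[ℂ] UniformSpace.Completion W := UniformSpace.Completion.toComplL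
  have hι : DenseRange ι := UniformSpace.Completion.denseRange_coe
  refine ⟨UniformSpace.Completion W, inferInstance, inferInstance, inferInstance,
    ⟨⟨ι.toLinearMap ∘ₗ e.symm.toLinearMap, L.extend ι, ?_, ?_, ?_⟩⟩⟩
  · have h := hι.comp e.symm.surjective.denseRange ι.continuous
    exact h
  · intro x
    refine (ContinuousLinearMap.extend_eq _ hι
      (UniformSpace.Completion.isUniformInducing_coe _) (e.symm x)).trans ?_
    change ((e (e.symm x) : Ac.domain) : H) = x
    rw [e.apply_symm_apply]
  · intro x y
    refine (UniformSpace.Completion.inner_coe _ _).trans ((he _ _).trans ?_)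
    simp

variable {Ac : H →ₗ.[ℂ] H} {c : ℝ} {V : Type*} [NormedAddCommGroup V] [InnerProductSpace ℂ V]

lemma FormCompletion.norm_incl_sq (F : FormCompletion Ac c V) (x : Ac.domain) :
    ‖F.incl x‖ ^ 2 = (inner ℂ (x : H) (Ac x)).re + c * ‖(x : H)‖ ^ 2 := by
  rw [← inner_self_eq_norm_sq (𝕜 := ℂ), F.inner_incl, map_add, RCLike.re_eq_complex_re,
    Complex.re_ofReal_mul, inner_self_eq_norm_sq_to_K]
  norm_cast

lemma FormCompletion.inner_self (F : FormCompletion Ac c V) (x : Ac.domain) :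
    inner ℂ (x : H) (Ac x) = ((‖F.incl x‖ ^ 2 - c * ‖(x : H)‖ ^ 2 : ℝ) : ℂ) := by
  have h := F.inner_incl x x
  rw [inner_self_eq_norm_sq_to_K, inner_self_eq_norm_sq_to_K] at h
  push_cast
  exact eq_sub_of_add_eq h.symm

/-- Form-approximating sequences are those that converge in the completion. -/
lemma FormCompletion.formApprox_iff [CompleteSpace V] (F : FormCompletion Ac c V)
    (a : ℕ → Ac.domain) (u : H) :
    FormApprox Ac a u ↔ ∃ α : V, Tendsto (fun n => F.incl (a n)) atTop (𝓝 α) ∧ F.toH α = u := by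
  -- The form and the squared norm of `V` differ by `c ‖a p - a q‖²`, which tends to `0` once `a`
  -- converges in `H`.
  have key : Tendsto (fun n => (a n : H)) atTop (𝓝 u) →
      (Tendsto (fun p : ℕ × ℕ => inner ℂ ((a p.1 - a p.2 : Ac.domain) : H) (Ac (a p.1 - a p.2)))
        atTop (𝓝 0) ↔ CauchySeq fun n => F.incl (a n)) := by
    intro ha
    have hd : Tendsto (fun p : ℕ × ℕ => c * ‖((a p.1 - a p.2 : Ac.domain) : H)‖ ^ 2) atTop
        (𝓝 0) := by
      have h1 := cauchySeq_iff_tendsto_dist_atTop_0.1 ha.cauchySeq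
      simp only [dist_eq_norm] at h1
      simpa using (h1.pow 2).const_mul c
    rw [cauchySeq_iff_tendsto_dist_atTop_0]
    simp only [dist_eq_norm, ← map_sub, F.inner_self]
    constructor
    · intro h
      have h1 := ((Complex.continuous_re.tendsto 0).comp h).add hd
      simp only [Function.comp_def, Complex.ofReal_re, Complex.zero_re, add_zero,
        sub_add_cancel] at h1
      simpa using h1.sqrt
    · intro h
      have h1 := (h.pow 2).sub hd
      rw [zero_pow two_ne_zero, sub_zero] at h1
      exact (Complex.continuous_ofReal.tendsto' 0 0 Complex.ofReal_zero).comp h1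
  constructor
  · rintro ⟨h1, h2⟩
    obtain ⟨α, hα⟩ := cauchySeq_tendsto_of_complete ((key h1).1 h2)
    refine ⟨α, hα, tendsto_nhds_unique ((F.toH.continuous.tendsto α).comp hα) ?_⟩
    simpa only [Function.comp_def, F.toH_incl] using h1
  · rintro ⟨α, hα, rfl⟩
    have h1 : Tendsto (fun n => (a n : H)) atTop (𝓝 (F.toH α)) := by
      simpa only [Function.comp_def, F.toH_incl] using (F.toH.continuous.tendsto α).comp hα
    exact ⟨h1, (key h1).2 hα.cauchySeq⟩

lemma FormCompletion.exists_formApprox_iff [CompleteSpace V] (F : FormCompletion Ac c V) (u : H) :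
    (∃ a, FormApprox Ac a u) ↔ u ∈ LinearMap.range F.toH.toLinearMap := by
  simp only [F.formApprox_iff]
  constructor
  · rintro ⟨a, α, -, h⟩
    exact ⟨α, h⟩
  · rintro ⟨α, h⟩
    obtain ⟨b, hb, hα⟩ := mem_closure_iff_seq_limit.1 (F.dense α)
    choose a ha using hb
    exact ⟨a, α, by simpa only [ha] using hα, h⟩

lemma FormCompletion.inner_incl_left (F : FormCompletion Ac c V)
    (hsymm : Ac.IsFormalAdjoint Ac) (v : Ac.domain) (γ : V) :
    inner ℂ (F.incl v) γ = inner ℂ (Ac v) (F.toH γ) + c * inner ℂ (v : H) (F.toH γ) := by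
  refine F.dense.induction_on (p := fun γ => inner ℂ (F.incl v) γ =
    inner ℂ (Ac v) (F.toH γ) + c * inner ℂ (v : H) (F.toH γ)) γ
    (isClosed_eq (by fun_prop) (by fun_prop)) fun x => ?_
  rw [F.inner_incl, F.toH_incl, hsymm]

variable [CompleteSpace H]

/-- The form of the completion represents the maximal operator. -/
lemma FormCompletion.inner_eq (F : FormCompletion Ac c V)
    (hdense : Dense (Ac.domain : Set H)) (hsymm : Ac.IsFormalAdjoint Ac)
    {α : V} {w : H} (hα : (F.toH α, w) ∈ Ac.adjoint.graph) (β : V) :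
    inner ℂ β α = inner ℂ (F.toH β) (w + (c : ℂ) • F.toH α) := by
  refine F.dense.induction_on (p := fun β => inner ℂ β α =
    inner ℂ (F.toH β) (w + (c : ℂ) • F.toH α)) β (isClosed_eq (by fun_prop) (by fun_prop))
    fun v => ?_
  rw [F.inner_incl_left hsymm, F.toH_incl, inner_add_right, inner_smul_right,
    (mem_graph_adjoint_iff hdense).1 hα _ _ (Ac.mem_graph v)]

end

section

universe u

variable {H : Type u} [NormedAddCommGroup H] [InnerProductSpace ℂ H]

lemma graph_le_closure_graph (Ac : H →ₗ.[ℂ] H) : Ac.graph ≤ Ac.closure.graph :=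
  LinearPMap.le_graph_of_le (LinearPMap.le_closure Ac)

lemma mem_graphOrthogonal_iff {A : H →ₗ.[ℂ] H} {S : Submodule ℂ H} {u : H} :
    u ∈ graphOrthogonal A S ↔ ∃ w, (u, w) ∈ A.graph ∧ ∀ x y, (x, y) ∈ A.graph → x ∈ S →
      inner ℂ y w + inner ℂ x u = 0 := by
  constructor
  · rintro ⟨hu, h⟩
    refine ⟨A ⟨u, hu⟩, A.mem_graph ⟨u, hu⟩, fun x y hxy hx => ?_⟩
    obtain ⟨x, rfl, rfl⟩ := (LinearPMap.mem_graph_iff _).1 hxy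
    exact h x hx
  · rintro ⟨w, hw, h⟩
    obtain ⟨u, rfl, rfl⟩ := (LinearPMap.mem_graph_iff _).1 hw
    exact ⟨u.2, fun v hv => h v (A v) (A.mem_graph v) hv⟩

variable [CompleteSpace H]

/-! ### The Friedrichs extension -/

section Friedrichs

variable {Ac : H →ₗ.[ℂ] H} {c : ℝ} {V : Type*} [NormedAddCommGroup V] [InnerProductSpace ℂ V]
  [CompleteSpace V]

/-- With `j = F.toH`, the operator `j j*` is a right inverse of `A + c`, with values in the form
domain. -/
lemma FormCompletion.mem_graph (F : FormCompletion Ac c V)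
    (hdense : Dense (Ac.domain : Set H)) (hsymm : Ac.IsFormalAdjoint Ac) (y : H) :
    (F.toH (F.toH.adjoint y), y - (c : ℂ) • F.toH (F.toH.adjoint y)) ∈ Ac.adjoint.graph := by
  rw [mem_graph_adjoint_iff hdense]
  intro x z hxz
  obtain ⟨x, rfl, rfl⟩ := (LinearPMap.mem_graph_iff _).1 hxz
  have h := F.inner_incl_left hsymm x (F.toH.adjoint y)
  rw [ContinuousLinearMap.adjoint_inner_right, F.toH_incl] at h
  rw [inner_sub_right, inner_smul_right, h]
  ring

/-- The maximal operator restricted to the form domain is selfadjoint. -/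
lemma FormCompletion.isSelfAdjoint (F : FormCompletion Ac c V)
    (hdense : Dense (Ac.domain : Set H)) (hsymm : Ac.IsFormalAdjoint Ac) {T : H →ₗ.[ℂ] H}
    (hd : Dense (T.domain : Set H))
    (hT : ∀ u w, (u, w) ∈ T.graph ↔
      (u, w) ∈ Ac.adjoint.graph ∧ u ∈ LinearMap.range F.toH.toLinearMap) :
    IsSelfAdjoint T := by
  rw [LinearPMap.isSelfAdjoint_def]
  refine LinearPMap.eq_of_eq_graph (Submodule.ext fun ⟨u, w⟩ => ?_)
  rw [mem_graph_adjoint_iff hd, hT]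
  constructor
  · intro h
    -- Testing the adjoint relation on the graph points `(j j* z, z - c j j* z)` for all `z`
    -- determines `u`.
    have hu : u = F.toH (F.toH.adjoint (w + (c : ℂ) • u)) := by
      refine ext_inner_left ℂ fun z => ?_
      have h1 := h _ _ ((hT _ _).2 ⟨F.mem_graph hdense hsymm z, ⟨_, rfl⟩⟩)
      rw [inner_sub_left, inner_smul_left, Complex.conj_ofReal, sub_eq_iff_eq_add] at h1
      rw [h1, ← inner_smul_right, ← inner_add_right,
        ← ContinuousLinearMap.adjoint_inner_right F.toH, ContinuousLinearMap.adjoint_inner_left]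
    have h2 := F.mem_graph hdense hsymm (w + (c : ℂ) • u)
    rw [← hu, add_sub_cancel_right] at h2
    exact ⟨h2, _, hu.symm⟩
  · rintro ⟨h1, α, rfl⟩ x y hxy
    obtain ⟨h2, β, rfl⟩ := (hT _ _).1 hxy
    have h3 := F.inner_eq hdense hsymm h1 β
    have h4 := F.inner_eq hdense hsymm h2 α
    rw [← inner_conj_symm, h4, inner_conj_symm, inner_add_left, inner_add_right, inner_smul_left,
      inner_smul_right, Complex.conj_ofReal] at h3
    exact add_right_cancel h3

/-- The domain of the Friedrichs extension is the intersection of the form domain with the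
maximal domain. -/
lemma FormCompletion.mem_friedrichsDomain_iff (F : FormCompletion Ac c V)
    (hdense : Dense (Ac.domain : Set H)) (hsymm : Ac.IsFormalAdjoint Ac) (u : H) :
    u ∈ friedrichsDomain Ac ↔
      u ∈ (maxOp Ac).domain ∧ u ∈ LinearMap.range F.toH.toLinearMap := by
  unfold friedrichsDomain
  rw [Set.mem_ofPred_eq, F.exists_formApprox_iff]
  constructor
  · rintro ⟨⟨α, rfl⟩, w, hw⟩
    refine ⟨?_, α, rfl⟩
    obtain ⟨a, ha⟩ := (F.exists_formApprox_iff (F.toH α)).2 ⟨α, rfl⟩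
    have hg : (F.toH α, w) ∈ Ac.adjoint.graph := by
      rw [mem_graph_adjoint_iff hdense]
      intro x z hxz
      obtain ⟨x, rfl, rfl⟩ := (LinearPMap.mem_graph_iff _).1 hxz
      -- Constant sequences in `D_c` suffice as test vectors to place `w` as `A u`.
      have h1 := hw a (fun _ => x) x ha
        ((F.formApprox_iff _ _).2 ⟨F.incl x, tendsto_const_nhds, F.toH_incl x⟩)
      refine tendsto_nhds_unique ?_ h1
      simp only [← hsymm x]
      exact tendsto_const_nhds.inner ha.1
    exact LinearPMap.mem_domain_of_mem_graph hg
  · rintro ⟨hu, α, rfl⟩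
    refine ⟨⟨α, rfl⟩, maxOp Ac ⟨_, hu⟩, fun a b v ha hb => ?_⟩
    have hg := (maxOp Ac).mem_graph ⟨_, hu⟩
    obtain ⟨α', hα, hαu⟩ := (F.formApprox_iff _ _).1 ha
    obtain ⟨β, hβ, rfl⟩ := (F.formApprox_iff _ _).1 hb
    change F.toH α' = F.toH α at hαu
    change (F.toH α, _) ∈ _ at hg
    rw [← hαu] at hg
    have h1 := (hβ.inner hα).sub ((hb.1.inner ha.1).const_mul (c : ℂ))
    rw [F.inner_eq hdense hsymm hg] at h1
    simp only [F.inner_incl, add_sub_cancel_right] at h1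
    convert h1 using 2
    rw [inner_add_right, inner_smul_right, hαu]
    exact (add_sub_cancel_right _ _).symm

end Friedrichs

/-! ### Extensions of the closure -/

section Extensions

variable {Ac : H →ₗ.[ℂ] H}

lemma le_maxOp (hdense : Dense (Ac.domain : Set H)) (hsymm : Ac.IsFormalAdjoint Ac) :
    Ac ≤ maxOp Ac :=
  hsymm.le_adjoint hdense

lemma isClosable (hdense : Dense (Ac.domain : Set H)) (hsymm : Ac.IsFormalAdjoint Ac) :
    Ac.IsClosable :=
  LinearPMap.isClosable_iff_exists_closed_extension.2
    ⟨_, LinearPMap.adjoint_isClosed hdense, le_maxOp hdense hsymm⟩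

lemma closure_graph_le (hdense : Dense (Ac.domain : Set H)) (hsymm : Ac.IsFormalAdjoint Ac)
    {T : H →ₗ.[ℂ] H} (hT : T.IsClosed) (hle : Ac.graph ≤ T.graph) :
    Ac.closure.graph ≤ T.graph := by
  rw [← (isClosable hdense hsymm).graph_closure_eq_closure_graph]
  exact Submodule.topologicalClosure_minimal _ hle hT

lemma closure_graph_le_maxOp (hdense : Dense (Ac.domain : Set H))
    (hsymm : Ac.IsFormalAdjoint Ac) : Ac.closure.graph ≤ (maxOp Ac).graph :=
  closure_graph_le hdense hsymm (LinearPMap.adjoint_isClosed hdense)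
    (LinearPMap.le_graph_of_le (le_maxOp hdense hsymm))

lemma mem_closure_graph_iff (hdense : Dense (Ac.domain : Set H))
    (hsymm : Ac.IsFormalAdjoint Ac) {x y : H} :
    (x, y) ∈ Ac.closure.graph ↔ x ∈ minDomain Ac ∧ (x, y) ∈ (maxOp Ac).graph := by
  constructor
  · exact fun h => ⟨LinearPMap.mem_domain_of_mem_graph h, closure_graph_le_maxOp hdense hsymm h⟩
  · rintro ⟨h1, h2⟩
    have h3 := Ac.closure.mem_graph ⟨x, h1⟩
    rwa [LinearPMap.mem_graph_snd_inj _ h2 (closure_graph_le_maxOp hdense hsymm h3) rfl]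

lemma mem_extension_graph_iff {D : Submodule ℂ H} {x w : H} :
    (x, w) ∈ (extension Ac D).graph ↔ x ∈ D ⊔ minDomain Ac ∧ (x, w) ∈ (maxOp Ac).graph := by
  constructor
  · intro h
    exact ⟨(LinearPMap.mem_domain_of_mem_graph h).1,
      LinearPMap.le_graph_of_le LinearPMap.domRestrict_le h⟩
  · rintro ⟨h1, h2⟩
    obtain ⟨y, rfl, rfl⟩ := (LinearPMap.mem_graph_iff _).1 h2
    exact (LinearPMap.mem_graph_iff _).2 ⟨⟨y, h1, y.2⟩, rfl, LinearPMap.domRestrict_apply rfl⟩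

lemma closure_graph_le_extension (hdense : Dense (Ac.domain : Set H))
    (hsymm : Ac.IsFormalAdjoint Ac) (D : Submodule ℂ H) :
    Ac.closure.graph ≤ (extension Ac D).graph := by
  rintro ⟨x, w⟩ h
  rw [mem_closure_graph_iff hdense hsymm] at h
  exact mem_extension_graph_iff.2 ⟨Submodule.mem_sup_right h.1, h.2⟩

/-- On the defect space `A (A e) = - e`. -/
lemma maxOp_maxOp_of_mem_defectSpace (hdense : Dense (Ac.domain : Set H))
    (hsymm : Ac.IsFormalAdjoint Ac) {e w : H} (h : (e, w) ∈ (maxOp Ac).graph)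
    (he : e ∈ defectSpace Ac) : (w, -e) ∈ (maxOp Ac).graph := by
  obtain ⟨w', hw', horth⟩ := mem_graphOrthogonal_iff.1 he
  rw [LinearPMap.mem_graph_snd_inj _ h hw' rfl, mem_graph_adjoint_iff hdense]
  intro x y hxy
  have h1 := (mem_closure_graph_iff hdense hsymm).1 (graph_le_closure_graph Ac hxy)
  rw [inner_neg_right, eq_neg_iff_add_eq_zero]
  exact horth x y h1.2 h1.1

/-! ### Orthogonal projection and Riesz representation on a closed graph -/

/-- The norm of `H × H` is the maximum norm; `WithLp 2` supplies the Hilbert structure whose inner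
product is `(·,·)_A` on the graph. -/
lemma exists_graph_projection {g : Submodule ℂ (H × H)} (hg : IsClosed (g : Set (H × H)))
    (p : H × H) : ∃ d ∈ g, ∀ q ∈ g, inner ℂ q.2 (p.2 - d.2) + inner ℂ q.1 (p.1 - d.1) = 0 := by
  let G : Submodule ℂ (WithLp 2 (H × H)) :=
    g.comap (WithLp.linearEquiv 2 ℂ (H × H)).toLinearMap
  have hG : IsClosed (G : Set (WithLp 2 (H × H))) :=
    hg.preimage (WithLp.prod_continuous_ofLp 2 H H)
  have : CompleteSpace G := hG.completeSpace_coe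
  refine ⟨WithLp.ofLp (G.starProjection (WithLp.toLp 2 p)),
    G.starProjection_apply_mem (WithLp.toLp 2 p), fun q hq => ?_⟩
  have h := (Submodule.mem_orthogonal _ _).1
    (G.sub_starProjection_mem_orthogonal (WithLp.toLp 2 p)) (WithLp.toLp 2 q) hq
  rw [WithLp.prod_inner_apply] at h
  rw [add_comm]
  exact h

lemma exists_graph_riesz {g : Submodule ℂ (H × H)} (hg : IsClosed (g : Set (H × H)))
    (f : g →ₗ[ℂ] ℂ) {C : ℝ} (hf : ∀ p : g, ‖f p‖ ^ 2 ≤ C ^ 2 * (‖p.1.1‖ ^ 2 + ‖p.1.2‖ ^ 2))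
    (hC : 0 ≤ C) :
    ∃ v ∈ g, ∀ p : g, f p = inner ℂ v.1 p.1.1 + inner ℂ v.2 p.1.2 := by
  let G : Submodule ℂ (WithLp 2 (H × H)) :=
    g.comap (WithLp.linearEquiv 2 ℂ (H × H)).toLinearMap
  have hG : IsClosed (G : Set (WithLp 2 (H × H))) :=
    hg.preimage (WithLp.prod_continuous_ofLp 2 H H)
  have : CompleteSpace G := hG.completeSpace_coe
  let r : G →ₗ[ℂ] g :=
    ((WithLp.linearEquiv 2 ℂ (H × H)).toLinearMap ∘ₗ G.subtype).codRestrict g fun p => p.2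
  let φ : G →L[ℂ] ℂ := (f ∘ₗ r).mkContinuous C fun p => by
    refine (sq_le_sq₀ (norm_nonneg _) (by positivity)).1 ((hf (r p)).trans_eq ?_)
    rw [mul_pow]
    congr 1
    exact (WithLp.prod_norm_sq_eq_of_L2 (p : WithLp 2 (H × H))).symm
  let v := (InnerProductSpace.toDual ℂ G).symm φ
  refine ⟨WithLp.ofLp (v : WithLp 2 (H × H)), v.2, fun p => ?_⟩
  let p' : G := ⟨WithLp.toLp 2 p.1, p.2⟩
  have h := InnerProductSpace.toDual_symm_apply (𝕜 := ℂ) (x := p') (y := φ)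
  rw [Submodule.coe_inner, WithLp.prod_inner_apply] at h
  exact h.symm

lemma exists_sub_mem_defectSpace (hdense : Dense (Ac.domain : Set H))
    (hsymm : Ac.IsFormalAdjoint Ac) {u : H} (hu : u ∈ (maxOp Ac).domain) :
    ∃ d ∈ minDomain Ac, u - d ∈ defectSpace Ac := by
  have h := (maxOp Ac).mem_graph ⟨u, hu⟩
  obtain ⟨d, hd, horth⟩ := exists_graph_projection
    (isClosable hdense hsymm).closure_isClosed (u, maxOp Ac ⟨u, hu⟩)
  have hd' := (mem_closure_graph_iff hdense hsymm).1 hd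
  refine ⟨d.1, hd'.1, mem_graphOrthogonal_iff.2 ⟨_, (maxOp Ac).graph.sub_mem h hd'.2, ?_⟩⟩
  intro x y hxy hx
  exact horth (x, y) ((mem_closure_graph_iff hdense hsymm).2 ⟨hx, hxy⟩)

lemma eq_zero_of_mem_defectSpace {u : H} (hu : u ∈ defectSpace Ac) (hu' : u ∈ minDomain Ac) :
    u = 0 := by
  obtain ⟨w, hw, h⟩ := mem_graphOrthogonal_iff.1 hu
  have h1 := congrArg Complex.re (h u w hw hu')
  rw [inner_self_eq_norm_sq_to_K, inner_self_eq_norm_sq_to_K] at h1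
  norm_cast at h1
  have h2 : ‖w‖ ^ 2 + ‖u‖ ^ 2 = 0 := h1
  have h3 : ‖u‖ ^ 2 = 0 := le_antisymm (by linarith [sq_nonneg ‖w‖]) (sq_nonneg _)
  simpa using h3

/-- A subspace of the defect space is determined by its sum with the minimal domain. -/
lemma eq_inf_defectSpace {D : Submodule ℂ H} (hD : D ≤ defectSpace Ac) :
    D = (D ⊔ minDomain Ac) ⊓ defectSpace Ac := by
  refine le_antisymm (le_inf le_sup_left hD) ?_
  rintro x ⟨hx, hx'⟩
  obtain ⟨y, hy, z, hz, rfl⟩ := Submodule.mem_sup.1 hx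
  have h : z ∈ defectSpace Ac := by
    have := Submodule.sub_mem _ hx' (hD hy)
    rwa [add_sub_cancel_left] at this
  rw [eq_zero_of_mem_defectSpace h hz, add_zero]
  exact hy

end Extensions

end

section

universe u

variable {H : Type u} [NormedAddCommGroup H] [InnerProductSpace ℂ H]

/-- This makes functionals in `H^(-1/2)` bounded for the graph norm, so that Riesz representation in
`(·,·)_A` applies to them. -/
lemma shiftedForm_le_graph_norm (c : ℝ) (p : H × H) :
    shiftedForm c p ≤ (1 + |c|) * (‖p.1‖ ^ 2 + ‖p.2‖ ^ 2) := by
  have h1 : (inner ℂ p.1 p.2).re ≤ ‖p.1‖ * ‖p.2‖ :=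
    (Complex.re_le_norm _).trans (norm_inner_le_norm _ _)
  have h2 := neg_abs_le c
  have h3 := abs_nonneg c
  unfold shiftedForm
  nlinarith [sq_nonneg (‖p.1‖ - ‖p.2‖), sq_nonneg ‖p.1‖, sq_nonneg ‖p.2‖,
    mul_nonneg h3 (sq_nonneg ‖p.2‖), mul_le_mul_of_nonneg_right h2 (sq_nonneg ‖p.1‖)]

variable [CompleteSpace H]

/-! ### The Sobolev spaces inside a Hilbert space of sequences -/

/-- The spaces `H^s` embed isometrically into a Hilbert space. -/
lemma exists_sobolev_isometry (T : H →ₗ.[ℂ] H) (s : ℝ) :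
    ∃ J : sobolev T s →ₗ[ℂ] lp (fun _ : spec T => H) 2, ∀ u, ‖J u‖ = sobolevNorm T s u := by
  have hterm : ∀ (u : H) (μ : spec T),
      ‖(((1 + ‖(μ : ℂ)‖) ^ s : ℝ) : ℂ) • eigenProj T μ u‖ ^ 2 = sobolevTerm T s u μ := by
    intro u μ
    have h0 : (0 : ℝ) ≤ 1 + ‖(μ : ℂ)‖ := by positivity
    rw [norm_smul, Complex.norm_real, Real.norm_of_nonneg (Real.rpow_nonneg h0 s), mul_pow,
      sobolevTerm, mul_comm 2 s, Real.rpow_mul h0, Real.rpow_two]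
  have hmem : ∀ u : sobolev T s, Memℓp
      (fun μ : spec T => (((1 + ‖(μ : ℂ)‖) ^ s : ℝ) : ℂ) • eigenProj T μ (u : H)) 2 := by
    intro u
    refine memℓp_gen ?_
    simp only [ENNReal.toReal_ofNat, Real.rpow_two, hterm]
    exact u.2
  refine ⟨{ toFun := fun u => ⟨_, hmem u⟩, map_add' := fun u v => ?_, map_smul' := fun r u => ?_ },
    fun u => ?_⟩
  · ext μ
    exact (congrArg _ (map_add (eigenProj T μ) (u : H) v)).trans (smul_add _ _ _)
  · ext μ
    exact (congrArg _ (map_smul (eigenProj T μ) r (u : H))).trans (smul_comm _ _ _)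
  · rw [sobolevNorm, lp.norm_eq_tsum_rpow (by simp), Real.sqrt_eq_rpow]
    simp only [ENNReal.toReal_ofNat, Real.rpow_two]
    congr 1
    exact tsum_congr fun μ => hterm u μ

/-! ### The quadratic form of a selfadjoint extension -/

section Extension

variable {Ac : H →ₗ.[ℂ] H}

lemma compactDomain_maxOp (hcompact : IsCompact (closure ((fun x : (maxOp Ac).domain => (x : H)) ''
      {x | ‖maxOp Ac x‖ ^ 2 + ‖(x : H)‖ ^ 2 ≤ 1}))) : CompactDomain (maxOp Ac) := by
  refine ⟨_, hcompact, fun x w h hxw => subset_closure ?_⟩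
  obtain ⟨x, rfl, rfl⟩ := (LinearPMap.mem_graph_iff _).1 h
  exact ⟨x, hxw, rfl⟩

lemma lower_bound_closure (hdense : Dense (Ac.domain : Set H)) (hsymm : Ac.IsFormalAdjoint Ac)
    {m : ℝ} (hm : ∀ x : Ac.domain, m * ‖(x : H)‖ ^ 2 ≤ (inner ℂ (x : H) (Ac x)).re) {p : H × H}
    (hp : p ∈ Ac.closure.graph) : m * ‖p.1‖ ^ 2 ≤ (inner ℂ p.1 p.2).re := by
  rw [← (isClosable hdense hsymm).graph_closure_eq_closure_graph] at hp
  have hc : IsClosed {p : H × H | m * ‖p.1‖ ^ 2 ≤ (inner ℂ p.1 p.2).re} :=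
    isClosed_le (by fun_prop) (Complex.continuous_re.comp (by fun_prop))
  refine closure_minimal ?_ hc hp
  rintro ⟨x, w⟩ h
  obtain ⟨x, rfl, rfl⟩ := (LinearPMap.mem_graph_iff _).1 h
  exact hm x

lemma exists_isResolvent_extension (hdense : Dense (Ac.domain : Set H))
    (hsymm : Ac.IsFormalAdjoint Ac)
    {m : ℝ} (hm : ∀ x : Ac.domain, m * ‖(x : H)‖ ^ 2 ≤ (inner ℂ (x : H) (Ac x)).re)
    (hS : CompactDomain (maxOp Ac))
    [FiniteDimensional ℂ ((maxOp Ac).domain ⧸ (minDomain Ac).submoduleOf (maxOp Ac).domain)]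
    {D : Submodule ℂ H} (hD : IsSelfAdjoint (extension Ac D)) :
    ∃ (c : ℝ) (R : H →L[ℂ] H), IsResolvent (extension Ac D) c R ∧ IsCompactOperator R ∧
      EigenvaluesGE (extension Ac D) (c + 1) := by
  have hle : (extension Ac D).graph ≤ (maxOp Ac).graph :=
    LinearPMap.le_graph_of_le LinearPMap.domRestrict_le
  refine exists_isResolvent_eigenvaluesGE hD (hS.mono hle) (P := (maxOp Ac).domain)
    (M := minDomain Ac) (m := m) LinearPMap.domRestrict_le.1 fun x w h hx => ?_
  exact lower_bound_closure hdense hsymm hm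
    ((mem_closure_graph_iff hdense hsymm).2 ⟨hx, hle h⟩)

end Extension

/-! ### The Friedrichs extension among the selfadjoint extensions -/

section Main

variable {Ac : H →ₗ.[ℂ] H} {c₀ : ℝ} {V : Type*} [NormedAddCommGroup V] [InnerProductSpace ℂ V]
  [CompleteSpace V]

/-- The defect part of the domain of the Friedrichs extension. -/
noncomputable def FormCompletion.defectDomain (F : FormCompletion Ac c₀ V) : Submodule ℂ H :=
  LinearMap.range F.toH.toLinearMap ⊓ defectSpace Ac

/-- The restriction of `A` to the form domain is selfadjoint, hence closed, and it extends `Ac`; so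
it extends the closure of `Ac`. -/
lemma FormCompletion.minDomain_le (F : FormCompletion Ac c₀ V)
    (hdense : Dense (Ac.domain : Set H)) (hsymm : Ac.IsFormalAdjoint Ac) :
    minDomain Ac ≤ LinearMap.range F.toH.toLinearMap := by
  set T := (maxOp Ac).domRestrict (LinearMap.range F.toH.toLinearMap) with hTdef
  have hT : ∀ u w, (u, w) ∈ T.graph ↔
      (u, w) ∈ Ac.adjoint.graph ∧ u ∈ LinearMap.range F.toH.toLinearMap := by
    intro u w
    constructor
    · intro h
      exact ⟨LinearPMap.le_graph_of_le LinearPMap.domRestrict_le h,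
        (LinearPMap.mem_domain_of_mem_graph h).1⟩
    · rintro ⟨h1, h2⟩
      obtain ⟨y, rfl, rfl⟩ := (LinearPMap.mem_graph_iff _).1 h1
      exact (LinearPMap.mem_graph_iff _).2 ⟨⟨y, h2, y.2⟩, rfl, LinearPMap.domRestrict_apply rfl⟩
  have hle : Ac.graph ≤ T.graph := by
    rintro ⟨u, w⟩ h
    refine (hT u w).2 ⟨LinearPMap.le_graph_of_le (le_maxOp hdense hsymm) h, ?_⟩
    exact ⟨F.incl ⟨u, LinearPMap.mem_domain_of_mem_graph h⟩, F.toH_incl _⟩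
  have hsa := F.isSelfAdjoint hdense hsymm
    (hdense.mono (LinearPMap.le_of_le_graph hle).1) hT
  intro x hx
  exact ((hT _ _).1 (closure_graph_le hdense hsymm hsa.isClosed hle
    (Ac.closure.mem_graph ⟨x, hx⟩))).2

lemma FormCompletion.defectDomain_sup (F : FormCompletion Ac c₀ V)
    (hdense : Dense (Ac.domain : Set H)) (hsymm : Ac.IsFormalAdjoint Ac) :
    F.defectDomain ⊔ minDomain Ac = (maxOp Ac).domain ⊓ LinearMap.range F.toH.toLinearMap := by
  refine le_antisymm (sup_le ?_ ?_) ?_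
  · rintro x ⟨h1, h2⟩
    exact ⟨h2.1, h1⟩
  · exact fun x hx => ⟨(LinearPMap.le_of_le_graph (closure_graph_le_maxOp hdense hsymm)).1 hx,
      F.minDomain_le hdense hsymm hx⟩
  · rintro x ⟨h1, h2⟩
    obtain ⟨d, hd, hxd⟩ := exists_sub_mem_defectSpace hdense hsymm h1
    rw [← sub_add_cancel x d]
    exact Submodule.add_mem_sup
      ⟨Submodule.sub_mem _ h2 (F.minDomain_le hdense hsymm hd), hxd⟩ hd

lemma FormCompletion.mem_graph_extension_iff (F : FormCompletion Ac c₀ V)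
    (hdense : Dense (Ac.domain : Set H)) (hsymm : Ac.IsFormalAdjoint Ac) (u w : H) :
    (u, w) ∈ (extension Ac F.defectDomain).graph ↔
      (u, w) ∈ Ac.adjoint.graph ∧ u ∈ LinearMap.range F.toH.toLinearMap := by
  rw [mem_extension_graph_iff, F.defectDomain_sup hdense hsymm]
  exact ⟨fun h => ⟨h.2, h.1.2⟩,
    fun h => ⟨⟨LinearPMap.mem_domain_of_mem_graph h.1, h.2⟩, h.1⟩⟩

lemma extension_dense_domain (hdense : Dense (Ac.domain : Set H))
    (hsymm : Ac.IsFormalAdjoint Ac) (D : Submodule ℂ H) :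
    Dense ((extension Ac D).domain : Set H) :=
  hdense.mono (LinearPMap.le_of_le_graph
    ((graph_le_closure_graph Ac).trans (closure_graph_le_extension hdense hsymm D))).1

lemma FormCompletion.defectDomain_mem (F : FormCompletion Ac c₀ V)
    (hdense : Dense (Ac.domain : Set H)) (hsymm : Ac.IsFormalAdjoint Ac) :
    F.defectDomain ∈ selfadjointDomains Ac :=
  ⟨inf_le_right, F.isSelfAdjoint hdense hsymm (extension_dense_domain hdense hsymm _)
    (F.mem_graph_extension_iff hdense hsymm)⟩

/-- If the domain of a selfadjoint extension lies in the form domain, the extension is the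
Friedrichs extension. -/
lemma FormCompletion.eq_defectDomain (F : FormCompletion Ac c₀ V)
    (hdense : Dense (Ac.domain : Set H)) (hsymm : Ac.IsFormalAdjoint Ac) {D : Submodule ℂ H}
    (hD : D ∈ selfadjointDomains Ac)
    (h : (extension Ac D).domain ≤ LinearMap.range F.toH.toLinearMap) : D = F.defectDomain := by
  have hF := F.defectDomain_mem hdense hsymm
  have hle : (extension Ac D).graph ≤ (extension Ac F.defectDomain).graph := by
    rintro ⟨u, w⟩ huw
    exact (F.mem_graph_extension_iff hdense hsymm u w).2
      ⟨(mem_extension_graph_iff.1 huw).2, h (LinearPMap.mem_domain_of_mem_graph huw)⟩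
  -- A selfadjoint operator has no proper symmetric extension.
  have hge : (extension Ac F.defectDomain).graph ≤ (extension Ac D).graph := by
    rintro ⟨u, w⟩ huw
    exact (mem_graph_iff_of_isSelfAdjoint hD.2).2
      fun x y hxy => inner_graph_comm hF.2 (hle hxy) huw
  have hdom : ∀ {D' : Submodule ℂ H}, D' ∈ selfadjointDomains Ac →
      (extension Ac D').domain = D' ⊔ minDomain Ac := by
    intro D' hD'
    refine inf_eq_left.2 (sup_le (fun x hx => ?_)
      (LinearPMap.le_of_le_graph (closure_graph_le_maxOp hdense hsymm)).1)
    exact (hD'.1 hx).1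
  rw [eq_inf_defectSpace hD.1, eq_inf_defectSpace hF.1, ← hdom hD, ← hdom hF,
    LinearPMap.eq_of_eq_graph (le_antisymm hle hge)]

/-! ### Boundary functionals and `H^(-1/2)`. -/

lemma boundaryFunctional_apply {D : Submodule ℂ H} {u : (maxOp Ac).domain} {w : H}
    (hu : ((u : H), w) ∈ (maxOp Ac).graph) (ψ : (extension Ac D).domain) :
    boundaryFunctional Ac D u ψ = inner ℂ (u : H) (extension Ac D ψ) - inner ℂ w (ψ : H) := by
  rw [LinearPMap.mem_graph_snd_inj _ hu ((maxOp Ac).mem_graph u) rfl]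
  rfl

lemma zero_mem_boundaryFunctionals (Ac : H →ₗ.[ℂ] H) (D : Submodule ℂ H) :
    0 ∈ boundaryFunctionals Ac D := by
  refine ⟨0, Submodule.zero_mem _, ?_⟩
  ext ψ
  rw [boundaryFunctional_apply (w := 0) (maxOp Ac).graph.zero_mem]
  simp

lemma zero_mem_negSobolev {T : H →ₗ.[ℂ] H} (hT : IsSelfAdjoint T) {c : ℝ} {R : H →L[ℂ] H}
    (hR : IsResolvent T c R) (hK : IsCompactOperator R) (hb : EigenvaluesGE T (c + 1)) :
    0 ∈ negSobolev T (1 / 2) :=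
  ⟨0, ⟨0, by simp⟩, fun ψ => ⟨domain_le_sobolev_half hT hR hK hb ψ.2, rfl⟩⟩

/-- Functionals in `H^(-1/2)` are bounded by the quadratic form. -/
lemma exists_norm_sq_le_shiftedForm {T : H →ₗ.[ℂ] H} (hT : IsSelfAdjoint T) {c : ℝ}
    {R : H →L[ℂ] H} (hR : IsResolvent T c R) (hK : IsCompactOperator R)
    (hb : EigenvaluesGE T (c + 1)) {f : Module.Dual ℂ T.domain} (hf : f ∈ negSobolev T (1 / 2)) :
    ∃ C, 0 ≤ C ∧ ∀ ψ, ‖f ψ‖ ^ 2 ≤ C * shiftedForm c ((ψ : H), T ψ) := by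
  obtain ⟨ℓ, ⟨C, hC⟩, hℓ⟩ := hf
  refine ⟨C ^ 2 * (2 + |c|), by positivity, fun ψ => ?_⟩
  obtain ⟨hψ, h1⟩ := hℓ ψ
  rw [← h1, mul_assoc]
  calc ‖ℓ ⟨ψ, hψ⟩‖ ^ 2 ≤ (C * sobolevNorm T (1 / 2) ⟨ψ, hψ⟩) ^ 2 := by
        gcongr
        exact hC _
    _ = C ^ 2 * sobolevNorm T (1 / 2) ⟨ψ, hψ⟩ ^ 2 := mul_pow _ _ _
    _ ≤ _ := by
        gcongr
        exact sobolevNorm_sq_le hT hR hK hb (T.mem_graph ψ) _ rfl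

/-- For the Friedrichs extension, a functional in `H^(-1/2)` that vanishes on the domain of `Ac`
is zero. -/
lemma FormCompletion.eq_zero_of_vanishes (F : FormCompletion Ac c₀ V)
    (hdense : Dense (Ac.domain : Set H)) (hsymm : Ac.IsFormalAdjoint Ac) {T : H →ₗ.[ℂ] H}
    (hT : IsSelfAdjoint T) (hgraph : ∀ u w, (u, w) ∈ T.graph ↔
      (u, w) ∈ Ac.adjoint.graph ∧ u ∈ LinearMap.range F.toH.toLinearMap)
    (hdom : Ac.domain ≤ T.domain) {c : ℝ} {R : H →L[ℂ] H}
    (hR : IsResolvent T c R) (hK : IsCompactOperator R) (hb : EigenvaluesGE T (c + 1))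
    {f : Module.Dual ℂ T.domain} (hf : f ∈ negSobolev T (1 / 2))
    (hvan : ∀ ψ : T.domain, (ψ : H) ∈ Ac.domain → f ψ = 0) : f = 0 := by
  obtain ⟨C, hC, hbound⟩ := exists_norm_sq_le_shiftedForm hT hR hK hb hf
  ext ψ
  obtain ⟨hψA, α, hα⟩ := (hgraph _ _).1 (T.mem_graph ψ)
  obtain ⟨a, ha⟩ := (F.exists_formApprox_iff (ψ : H)).2 ⟨α, hα⟩
  obtain ⟨α', hα', hα'ψ⟩ := (F.formApprox_iff _ _).1 ha
  -- `f` takes the constant value `f ψ` on `d n`, while the form of `d n`, which controls `f`, tends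
  -- to `0`.
  let d : ℕ → T.domain := fun n => ψ - ⟨a n, hdom (a n).2⟩
  have hfd : ∀ n, f (d n) = f ψ := fun n => by rw [map_sub, hvan ⟨a n, hdom (a n).2⟩ (a n).2, sub_zero]
  have hform : ∀ n, shiftedForm c ((d n : H), T (d n)) =
      ‖α' - F.incl (a n)‖ ^ 2 - (c₀ + c) * ‖(d n : H)‖ ^ 2 := by
    intro n
    have hd : F.toH (α' - F.incl (a n)) = d n := by
      rw [map_sub, F.toH_incl, hα'ψ]
      rfl
    have hg : (F.toH (α' - F.incl (a n)), T (d n)) ∈ Ac.adjoint.graph := by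
      rw [hd]
      exact ((hgraph _ _).1 (T.mem_graph (d n))).1
    have h1 := congrArg Complex.re (F.inner_eq hdense hsymm hg (α' - F.incl (a n)))
    rw [hd, inner_add_right, inner_smul_right, inner_self_eq_norm_sq_to_K,
      inner_self_eq_norm_sq_to_K, Complex.add_re, Complex.re_ofReal_mul] at h1
    norm_cast at h1
    have h2 : ‖α' - F.incl (a n)‖ ^ 2 =
      (inner ℂ (d n : H) (T (d n))).re + c₀ * ‖(d n : H)‖ ^ 2 := h1
    rw [shiftedForm, h2]
    ring
  have hlim : Tendsto (fun n => C * shiftedForm c ((d n : H), T (d n))) atTop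
      (𝓝 0) := by
    simp only [hform]
    have h1 : Tendsto (fun n => ‖α' - F.incl (a n)‖ ^ 2) atTop (𝓝 0) := by
      simpa using ((tendsto_const_nhds (x := α')).sub hα').norm.pow 2
    have h2 : Tendsto (fun n => ‖(d n : H)‖ ^ 2) atTop (𝓝 0) := by
      simpa [d] using ((tendsto_const_nhds (x := (ψ : H))).sub ha.1).norm.pow 2
    simpa using (h1.sub (h2.const_mul (c₀ + c))).const_mul C
  have h0 : ‖f ψ‖ ^ 2 ≤ 0 := ge_of_tendsto' hlim fun n => by
    rw [← hfd n]
    exact hbound (d n)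
  simpa using le_antisymm h0 (sq_nonneg _)

/-- Riesz representation of functionals on the domain that are bounded for the graph norm. -/
lemma exists_domain_riesz {T : H →ₗ.[ℂ] H} (hT : T.IsClosed) {f : Module.Dual ℂ T.domain} {C : ℝ}
    (hC : 0 ≤ C) (hf : ∀ ψ, ‖f ψ‖ ^ 2 ≤ C * (‖(ψ : H)‖ ^ 2 + ‖T ψ‖ ^ 2)) :
    ∃ v w, (v, w) ∈ T.graph ∧ ∀ ψ, f ψ = inner ℂ v (ψ : H) + inner ℂ w (T ψ) := by
  let pr : T.graph →ₗ[ℂ] T.domain :=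
    (LinearMap.fst ℂ H H ∘ₗ T.graph.subtype).codRestrict T.domain
      fun p => LinearPMap.mem_domain_of_mem_graph p.2
  have hpr : ∀ p : T.graph, T (pr p) = p.1.2 := fun p =>
    LinearPMap.mem_graph_snd_inj _ (T.mem_graph (pr p)) p.2 rfl
  obtain ⟨⟨v, w⟩, hvw, hrep⟩ := exists_graph_riesz hT (f ∘ₗ pr) (C := √C)
    (fun p => by
      have h := hf (pr p)
      rw [hpr] at h
      rw [Real.sq_sqrt hC]
      exact h) (Real.sqrt_nonneg C)
  exact ⟨v, w, hvw, fun ψ => hrep ⟨_, T.mem_graph ψ⟩⟩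

/-- A functional on the domain of a selfadjoint extension that is bounded for the graph norm and
vanishes on the domain of `Ac` is a boundary functional. -/
lemma mem_boundaryFunctionals (hdense : Dense (Ac.domain : Set H))
    (hsymm : Ac.IsFormalAdjoint Ac) {D : Submodule ℂ H} (hD : IsSelfAdjoint (extension Ac D))
    {f : Module.Dual ℂ (extension Ac D).domain} {C : ℝ} (hC : 0 ≤ C)
    (hf : ∀ ψ, ‖f ψ‖ ^ 2 ≤ C * (‖(ψ : H)‖ ^ 2 + ‖extension Ac D ψ‖ ^ 2))
    (hvan : ∀ ψ : (extension Ac D).domain, (ψ : H) ∈ Ac.domain → f ψ = 0) :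
    f ∈ boundaryFunctionals Ac D := by
  obtain ⟨v, w, hvw, hrep⟩ := exists_domain_riesz hD.isClosed hC hf
  have hvA := (mem_extension_graph_iff.1 hvw).2
  -- Orthogonality to `D_c` is the vanishing of `f` there; it is a closed condition on the graph, so
  -- it extends to `D_min`.
  have hv : v ∈ defectSpace Ac := by
    refine mem_graphOrthogonal_iff.2 ⟨w, hvA, fun x y hxy hx => ?_⟩
    have hp := (mem_closure_graph_iff hdense hsymm).2 ⟨hx, hxy⟩
    rw [← (isClosable hdense hsymm).graph_closure_eq_closure_graph] at hp
    have hc : IsClosed {p : H × H | inner ℂ p.2 w + inner ℂ p.1 v = 0} :=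
      isClosed_eq (by fun_prop) continuous_const
    refine closure_minimal ?_ hc hp
    rintro ⟨x, y⟩ h
    obtain ⟨ψ, rfl, rfl⟩ := (LinearPMap.mem_graph_iff _).1
      (closure_graph_le_extension hdense hsymm D (graph_le_closure_graph Ac h))
    have h1 := hrep ψ
    rw [hvan _ (LinearPMap.mem_domain_of_mem_graph h)] at h1
    have h2 := congrArg (starRingEnd ℂ) h1
    rw [map_zero, map_add, inner_conj_symm, inner_conj_symm] at h2
    rw [Set.mem_ofPred_eq, add_comm]
    exact h2.symm
  have hw := maxOp_maxOp_of_mem_defectSpace hdense hsymm hvA hv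
  -- Here `w = Av` and `Aw = -v`, so for `x` in the domain of the extension `(w, x)_A = -(v, Ax) +
  -- (Av, x)`, which is zero by symmetry because `v` lies in that domain too.
  have horth : ∀ x y, (x, y) ∈ (maxOp Ac).graph → x ∈ D ⊔ minDomain Ac →
      inner ℂ y (-v) + inner ℂ x w = 0 := by
    intro x y hxy hx
    rw [inner_neg_right, inner_graph_comm hD (mem_extension_graph_iff.2 ⟨hx, hxy⟩) hvw,
      neg_add_cancel]
  refine ⟨⟨w, LinearPMap.mem_domain_of_mem_graph hw⟩, ⟨?_, ?_⟩, ?_⟩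
  · exact mem_graphOrthogonal_iff.2 ⟨_, hw, fun x y hxy hx =>
      horth x y hxy (Submodule.mem_sup_left hx)⟩
  · exact mem_graphOrthogonal_iff.2 ⟨_, hw, fun x y hxy hx =>
      horth x y hxy (Submodule.mem_sup_right hx)⟩
  · ext ψ
    rw [boundaryFunctional_apply hw, hrep, inner_neg_left, sub_neg_eq_add, add_comm]

/-- If no nonzero functional in `H^(-1/2)` vanishes on the domain of `Ac`, then the domain of
the selfadjoint extension is contained in the form domain. -/
lemma FormCompletion.domain_le (F : FormCompletion Ac c₀ V) {T : H →ₗ.[ℂ] H}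
    (hT : IsSelfAdjoint T) (hle : Ac.graph ≤ T.graph) {c : ℝ} {R : H →L[ℂ] H}
    (hR : IsResolvent T c R) (hK : IsCompactOperator R) (hb : EigenvaluesGE T (c + 1))
    (hzero : ∀ f ∈ negSobolev T (1 / 2), (∀ ψ : T.domain, (ψ : H) ∈ Ac.domain → f ψ = 0) →
      f = 0) :
    T.domain ≤ LinearMap.range F.toH.toLinearMap := by
  have hdom : Ac.domain ≤ T.domain := (LinearPMap.le_of_le_graph hle).1
  have hsob := domain_le_sobolev_half hT hR hK hb
  obtain ⟨J, hJ⟩ := exists_sobolev_isometry T (1 / 2)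
  let J' : T.domain →ₗ[ℂ] lp (fun _ : spec T => H) 2 := J ∘ₗ Submodule.inclusion hsob
  have hJ2 : ∀ ψ : T.domain, shiftedForm c ((ψ : H), T ψ) ≤ (1 + |c|) * ‖J' ψ‖ ^ 2 := fun ψ => by
    rw [LinearMap.comp_apply, hJ]
    exact shiftedForm_le hT hR hK hb (T.mem_graph ψ) _ rfl
  have hnorm : ∀ ψ : T.domain, ‖(ψ : H)‖ ^ 2 ≤ shiftedForm c ((ψ : H), T ψ) := fun ψ =>
    norm_sq_le_shiftedForm hT hR hK hb (T.mem_graph ψ)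
  let J₀ : Ac.domain →ₗ[ℂ] lp (fun _ : spec T => H) 2 := J' ∘ₗ Submodule.inclusion hdom
  let K := (LinearMap.range J₀).topologicalClosure
  -- Density by duality: a vector `z` orthogonal to `K` yields the functional `(J ·, z)` in
  -- `H^(-1/2)`, which vanishes on `D_c` and hence everywhere. So `J' ψ` lies in the double
  -- complement of `K`, which is `K`.
  have hKmem : ∀ ψ, J' ψ ∈ K := by
    intro ψ₀
    have : CompleteSpace K := (Submodule.isClosed_topologicalClosure _).completeSpace_coe
    rw [← Submodule.orthogonal_orthogonal K, Submodule.mem_orthogonal]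
    intro z hz
    let ℓ : Module.Dual ℂ (sobolev T (1 / 2)) := (innerSL ℂ z).toLinearMap ∘ₗ J
    have hℓ : ∀ w, ‖ℓ w‖ ≤ ‖z‖ * sobolevNorm T (1 / 2) w := fun w => by
      rw [← hJ]
      exact norm_inner_le_norm (𝕜 := ℂ) z (J w)
    let f : Module.Dual ℂ T.domain := ℓ ∘ₗ Submodule.inclusion hsob
    have hf : f ∈ negSobolev T (1 / 2) := ⟨ℓ, ⟨_, hℓ⟩, fun ψ => ⟨hsob ψ.2, rfl⟩⟩
    exact LinearMap.congr_fun (hzero f hf fun ψ hψ => (Submodule.mem_orthogonal' _ _).1 hz _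
      (Submodule.le_topologicalClosure _ ⟨⟨ψ, hψ⟩, rfl⟩)) ψ₀
  intro ψ hψ
  obtain ⟨b, hb', hlim⟩ := mem_closure_iff_seq_limit.1 (hKmem ⟨ψ, hψ⟩)
  choose a ha using hb'
  obtain rfl : b = fun n => J₀ (a n) := funext fun n => (ha n).symm
  -- The first factor changes the shift of the form from `-c` to `c₀`; the second passes from the
  -- form to the `H^(1/2)` norm.
  set B := (1 + |c + c₀|) * (1 + |c|) with hB
  have hincl : ∀ x, ‖F.incl x‖ ^ 2 ≤ B * ‖J₀ x‖ ^ 2 := by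
    intro x
    let x' : T.domain := ⟨x, hdom x.2⟩
    have hTx : T x' = Ac x :=
      LinearPMap.mem_graph_snd_inj _ (T.mem_graph x') (hle (Ac.mem_graph x)) rfl
    have h1 : ‖F.incl x‖ ^ 2 = shiftedForm c ((x' : H), T x') + (c + c₀) * ‖(x' : H)‖ ^ 2 := by
      rw [F.norm_incl_sq, hTx, shiftedForm]
      ring
    have h2 : (c + c₀) * ‖(x' : H)‖ ^ 2 ≤ |c + c₀| * shiftedForm c ((x' : H), T x') :=
      mul_le_mul (le_abs_self _) (hnorm x') (by positivity) (abs_nonneg _)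
    calc ‖F.incl x‖ ^ 2 ≤ (1 + |c + c₀|) * shiftedForm c ((x' : H), T x') := by
          rw [h1, add_mul 1, one_mul]
          gcongr
      _ ≤ (1 + |c + c₀|) * ((1 + |c|) * ‖J' x'‖ ^ 2) := by
          gcongr
          exact hJ2 x'
      _ = B * ‖J₀ x‖ ^ 2 := by
          rw [hB, mul_assoc]
          rfl
  have hcauchy : CauchySeq fun n => F.incl (a n) := by
    have h1 := cauchySeq_iff_tendsto_dist_atTop_0.1 hlim.cauchySeq
    rw [cauchySeq_iff_tendsto_dist_atTop_0]
    simp only [dist_eq_norm, ← map_sub] at h1 ⊢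
    have h2 : Tendsto (fun p : ℕ × ℕ => √B * ‖J₀ (a p.1 - a p.2)‖) atTop (𝓝 0) := by
      simpa using h1.const_mul (√B)
    refine squeeze_zero (fun p => norm_nonneg _) (fun p => ?_) h2
    refine (sq_le_sq₀ (norm_nonneg _) (by positivity)).1 ?_
    rw [mul_pow, Real.sq_sqrt (by positivity)]
    exact hincl _
  obtain ⟨α, hα⟩ := cauchySeq_tendsto_of_complete hcauchy
  refine ⟨α, ?_⟩
  have h1 : Tendsto (fun n => (a n : H)) atTop (𝓝 (F.toH α)) := by
    simpa only [Function.comp_def, F.toH_incl] using (F.toH.continuous.tendsto α).comp hα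
  -- The `H^(1/2)` norm dominates the norm of `H`, so `a n` also tends to `ψ` in `H`, and the two
  -- limits agree.
  refine tendsto_nhds_unique h1 ?_
  rw [tendsto_iff_norm_sub_tendsto_zero] at hlim ⊢
  have h2 : Tendsto (fun n => √(1 + |c|) * ‖J₀ (a n) - J' ⟨ψ, hψ⟩‖) atTop (𝓝 0) := by
    simpa using hlim.const_mul (√(1 + |c|))
  refine squeeze_zero (fun n => norm_nonneg _) (fun n => ?_) h2
  refine (sq_le_sq₀ (norm_nonneg _) (by positivity)).1 ?_
  rw [mul_pow, Real.sq_sqrt (by positivity)]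
  let x' : T.domain := ⟨a n, hdom (a n).2⟩
  have h3 := (hnorm (x' - ⟨ψ, hψ⟩)).trans (hJ2 (x' - ⟨ψ, hψ⟩))
  rw [map_sub] at h3
  exact h3

/-- The Friedrichs extension is characterized by the absence of nonzero boundary functionals in
`H^(-1/2)`. -/
lemma FormCompletion.inter_eq_zero_iff (F : FormCompletion Ac c₀ V)
    (hdense : Dense (Ac.domain : Set H)) (hsymm : Ac.IsFormalAdjoint Ac) {D : Submodule ℂ H}
    (hD : D ∈ selfadjointDomains Ac) {c : ℝ} {R : H →L[ℂ] H}
    (hR : IsResolvent (extension Ac D) c R) (hK : IsCompactOperator R)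
    (hb : EigenvaluesGE (extension Ac D) (c + 1)) :
    boundaryFunctionals Ac D ∩ negSobolev (extension Ac D) (1 / 2) = {0} ↔
      D = F.defectDomain := by
  have hle : Ac.graph ≤ (extension Ac D).graph :=
    (graph_le_closure_graph Ac).trans (closure_graph_le_extension hdense hsymm _)
  constructor
  · intro h
    refine F.eq_defectDomain hdense hsymm hD
      (F.domain_le hD.2 hle hR hK hb fun f hf hvan => h.subset ⟨?_, hf⟩)
    obtain ⟨C, hC, hbound⟩ := exists_norm_sq_le_shiftedForm hD.2 hR hK hb hf
    refine mem_boundaryFunctionals hdense hsymm hD.2 (C := C * (1 + |c|)) (by positivity)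
      (fun ψ => (hbound ψ).trans ?_) hvan
    rw [mul_assoc]
    exact mul_le_mul_of_nonneg_left (shiftedForm_le_graph_norm c _) hC
  · rintro rfl
    refine Set.Subset.antisymm ?_ ?_
    · rintro f ⟨⟨u, -, rfl⟩, hf⟩
      refine F.eq_zero_of_vanishes hdense hsymm hD.2 (F.mem_graph_extension_iff hdense hsymm)
        (LinearPMap.le_of_le_graph hle).1 hR hK hb hf fun ψ hψ => ?_
      have hg := (maxOp Ac).mem_graph u
      have h1 := (mem_graph_adjoint_iff hdense).1 hg ψ _ (Ac.mem_graph ⟨ψ, hψ⟩)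
      rw [boundaryFunctional_apply hg, sub_eq_zero, ← inner_conj_symm,
        LinearPMap.mem_graph_snd_inj _ (LinearPMap.mem_graph _ ψ) (hle (Ac.mem_graph ⟨ψ, hψ⟩)) rfl,
        h1, inner_conj_symm]
    · rintro _ rfl
      exact ⟨zero_mem_boundaryFunctionals Ac _, zero_mem_negSobolev hD.2 hR hK hb⟩

end Main

end

end SADomains

theorem theorem6p10 {H : Type*} [NormedAddCommGroup H] [InnerProductSpace ℂ H]
    [CompleteSpace H] [TopologicalSpace.SeparableSpace H]
    (Ac : H →ₗ.[ℂ] H)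
    (hdense : Dense (Ac.domain : Set H))
    (hsymm : Ac.IsFormalAdjoint Ac)
    (hbdd : ∃ m : ℝ, ∀ x : Ac.domain, m * ‖(x : H)‖ ^ 2 ≤ (inner ℂ (x : H) (Ac x)).re)
    (hcompact : IsCompact (closure ((fun x : (SADomains.maxOp Ac).domain => (x : H)) ''
      {x | ‖SADomains.maxOp Ac x‖ ^ 2 + ‖(x : H)‖ ^ 2 ≤ 1})))
    (hfin : FiniteDimensional ℂ ((SADomains.maxOp Ac).domain ⧸
      (SADomains.minDomain Ac).submoduleOf (SADomains.maxOp Ac).domain))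
    (hpos : 0 < Module.finrank ℂ ((SADomains.maxOp Ac).domain ⧸
      (SADomains.minDomain Ac).submoduleOf (SADomains.maxOp Ac).domain)) :
    ∃ DF ∈ SADomains.selfadjointDomains Ac,
      ((DF ⊔ SADomains.minDomain Ac : Submodule ℂ H) : Set H) = SADomains.friedrichsDomain Ac ∧
      ∀ D ∈ SADomains.selfadjointDomains Ac,
        SADomains.boundaryFunctionals Ac D ∩
            SADomains.negSobolev (SADomains.extension Ac D) (1 / 2) = {0} ↔
          D = DF := by
  obtain ⟨m, hm⟩ := hbdd
  -- The shift `1 - m` makes the form at least `‖x‖²`.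
  have hc : ∀ x : Ac.domain,
      ‖(x : H)‖ ^ 2 ≤ (inner ℂ (x : H) (Ac x)).re + ((1 - m : ℝ)) * ‖(x : H)‖ ^ 2 := fun x => by
    linarith [hm x]
  obtain ⟨V, _, _, _, ⟨F⟩⟩ := SADomains.exists_formCompletion Ac hsymm hc
  have hS := SADomains.compactDomain_maxOp hcompact
  refine ⟨F.defectDomain, F.defectDomain_mem hdense hsymm, ?_, fun D hD => ?_⟩
  · ext u
    rw [F.mem_friedrichsDomain_iff hdense hsymm, F.defectDomain_sup hdense hsymm]
    rfl
  · obtain ⟨c, R, hR, hK, hb⟩ :=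
      SADomains.exists_isResolvent_extension hdense hsymm hm hS hD.2
    exact F.inter_eq_zero_iff hdense hsymm hD hR hK hb
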